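/- **Lemma 4.1.** Let $\mathfrak g$ be a finite-dimensional complex simple Lie algebra of type $D_n$ ($n\ge 4$) or $E_6$, $\mathfrak h$ a Cartan subalgebra, $\Omega$ the root system, $\Omega^+$ a system of positive roots and $\Pi$ the set of simple roots. Let $E_\alpha$ ($\alpha\in\Omega$) be root vectors with $(E_\alpha,E_{-\alpha})=1$ for the Killing form, and let $\theta$ be a Cartan automorphism of $\mathfrak g$, that is, a Lie algebra automorphism with $\theta|_{\mathfrak h}=-1$. For $\Gamma\subseteq\Pi$ let $\Omega_\Gamma$ be the set of roots in the span of $\Gamma$, let $\mathfrak g_\Gamma$ be the Levi subalgebra generated by $\mathfrak h$ and the $E_{\pm\alpha}$, $\alpha\in\Gamma$, and let $\mathfrak m=\bigoplus_{\alpha\in\Omega\setminus\Omega_\Gamma}\mathbb C E_\alpha$ be its invariant complement. Let $\pi:\wedge^\bullet\mathfrak g\to\wedge^\bullet\mathfrak m$ be induced by the projection of $\mathfrak g$ onto $\mathfrak m$ along $\mathfrak g_\Gamma$, and let $$[\![X_1\wedge X_2,Y_1\wedge Y_2]\!]=[X_1,Y_1]\wedge X_2\wedge Y_2-[X_1,Y_2]\wedge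 X_2\wedge Y_1-[X_2,Y_1]\wedge X_1\wedge Y_2+[X_2,Y_2]\wedge X_1\wedge Y_1$$ be the Schouten bracket. Put $r=\sum_{\alpha\in\Omega^+}E_\alpha\wedge E_{-\alpha}$, $\varphi=[\![r,r]\!]\in\wedge^3\mathfrak g$ and $\varphi_M=\pi(\varphi)\in\wedge^3\mathfrak m$. Suppose that $\Gamma$ defines a good orbit $M=G/G_\Gamma$, that is: for some $t\in\mathfrak h$ with $\alpha(t)=0$ for $\alpha\in\Gamma$ and $\alpha(t)\ne0$ for $\alpha\in\Omega\setminus\Omega_\Gamma$, there are $f\in(\wedge^2\mathfrak m)^{\mathfrak g_\Gamma}$ and $K\in\mathbb C\setminus\{0\}$ with $$\pi[\![f,f]\!]=K^2\varphi_M,\qquad \pi[\![f,v]\!]=0,\qquad\text{where } v=\sum_{\alpha\in\Omega^+\setminus\Omega_\Gamma}\frac1{\alpha(t)}\,E_\alpha\wedge E_{-\alpha}$$ is the Kirillov–Kostant–Souriau bivector of the orbit through $t$. Then the space of $\mathfrak g_\Gamma$- and $\theta$-invariant elements of $\wedge^3\mathfrak m$ is spanned by $\varphi_M$: $$(\wedge^3\mathfrak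 m)^{\mathfrak g_\Gamma,\theta}=\mathbb C\,\varphi_M .$$ If moreover $M$ is not a symmetric space (that is, $[\mathfrak m,\mathfrak m]\not\subseteq\mathfrak g_\Gamma$), this space is one-dimensional. -/

import Mathlib

open scoped ExteriorAlgebra

noncomputable section

namespace LieOrbit

/-! ### Multilinear algebra: extension of an operator, Schouten bracket -/

section Exterior

theorem update_vec₃_zero {V : Type*} (A X Y Z : V) : Function.update ![X, Y, Z] 0 A = ![A, Y, Z] := by
  funext i; fin_cases i <;> rfl

theorem update_vec₃_one {V : Type*} (A X Y Z : V) : Function.update ![X, Y, Z] 1 A = ![X, A, Z] := by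
  funext i; fin_cases i <;> rfl

theorem update_vec₃_two {V : Type*} (A X Y Z : V) : Function.update ![X, Y, Z] 2 A = ![X, Y, A] := by
  funext i; fin_cases i <;> rfl

variable {L : Type*} [LieRing L] [LieAlgebra ℂ L]

/-- The alternating map `(X₁, …, Xₙ) ↦ ∑ᵢ X₁ ∧ ⋯ ∧ f Xᵢ ∧ ⋯ ∧ Xₙ`. -/
def derivationAlt (n : ℕ) (f : L →ₗ[ℂ] L) : L [⋀^Fin n]→ₗ[ℂ] ⋀[ℂ]^n L :=
  { (∑ i : Fin n, (exteriorPower.ιMulti ℂ n (M := L)).toMultilinearMap.compLinearMap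
      (fun j => if j = i then f else LinearMap.id)) with
    map_eq_zero_of_eq' := by
      intro v i j hv hij
      have key : ∀ k : Fin n, (fun l => (if l = k then f else LinearMap.id) (v l)) =
          Function.update v k (f (v k)) := by
        intro k
        funext l
        by_cases h : l = k
        · subst h; simp
        · simp [h]
      have hz : ∀ k : Fin n, k ≠ i → k ≠ j →
          exteriorPower.ιMulti ℂ n (Function.update v k (f (v k))) = 0 := by
        intro k hki hkj
        refine AlternatingMap.map_eq_zero_of_eq _ _ (i := i) (j := j) ?_ hij
        rw [Function.update_of_ne hki.symm, Function.update_of_ne hkj.symm, hv]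
      have hs : Function.update v j (f (v j)) = Function.update v i (f (v i)) ∘ Equiv.swap i j := by
        funext l
        by_cases h1 : l = i
        · subst h1
          simp [Function.update_of_ne hij, Function.update_of_ne hij.symm, hv]
        · by_cases h2 : l = j
          · subst h2; simp [hv]
          · simp [Equiv.swap_apply_of_ne_of_ne h1 h2, Function.update_of_ne h1,
              Function.update_of_ne h2]
      simp only [MultilinearMap.toFun_eq_coe, sum_apply,
        MultilinearMap.compLinearMap_apply, AlternatingMap.coe_multilinearMap, key]
      rw [← Finset.sum_subset (Finset.subset_univ {i, j}) (fun k _ hk => by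
        simp only [Finset.mem_insert, Finset.mem_singleton, not_or] at hk
        exact hz k hk.1 hk.2), Finset.sum_pair hij, hs, AlternatingMap.map_swap _ _ hij,
        add_neg_cancel] }

theorem derivationAlt_apply (n : ℕ) (f : L →ₗ[ℂ] L) (v : Fin n → L) :
    derivationAlt n f v =
      ∑ i, exteriorPower.ιMulti ℂ n (Function.update v i (f (v i))) := by
  change (∑ i : Fin n, (exteriorPower.ιMulti ℂ n (M := L)).toMultilinearMap.compLinearMap
      (fun j => if j = i then f else LinearMap.id)) v = _
  rw [sum_apply]
  refine Finset.sum_congr rfl fun i _ => ?_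
  rw [MultilinearMap.compLinearMap_apply]
  change exteriorPower.ιMulti ℂ n _ = _
  congr 1
  funext l
  by_cases h : l = i
  · subst h; simp
  · simp [h]

/-- The adjoint action of `x ∈ L` on `⋀ⁿ L`:
`x · (X₁ ∧ ⋯ ∧ Xₙ) = ∑ᵢ X₁ ∧ ⋯ ∧ [x, Xᵢ] ∧ ⋯ ∧ Xₙ`. -/
def adExt (n : ℕ) (x : L) : ⋀[ℂ]^n L →ₗ[ℂ] ⋀[ℂ]^n L :=
  exteriorPower.alternatingMapLinearEquiv (derivationAlt n (LieAlgebra.ad ℂ L x))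

theorem adExt_ιMulti (n : ℕ) (x : L) (v : Fin n → L) :
    adExt n x (exteriorPower.ιMulti ℂ n v) =
      ∑ i, exteriorPower.ιMulti ℂ n (Function.update v i ⁅x, v i⁆) := by
  simp [adExt, derivationAlt_apply]

/-- `X ∧ Y` in `⋀² L`. -/
def wedge₂ (X Y : L) : ⋀[ℂ]^2 L := exteriorPower.ιMulti ℂ 2 ![X, Y]

/-- `X ∧ Y ∧ Z` in `⋀³ L`. -/
def wedge₃ (X Y Z : L) : ⋀[ℂ]^3 L := exteriorPower.ιMulti ℂ 3 ![X, Y, Z]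

theorem wedge₃_add_left (X Y Z X' : L) :
    wedge₃ (X + X') Y Z = wedge₃ X Y Z + wedge₃ X' Y Z := by
  have h := (exteriorPower.ιMulti ℂ 3 (M := L)).map_update_add ![X, Y, Z] 0 X X'
  rwa [update_vec₃_zero, update_vec₃_zero, update_vec₃_zero] at h

theorem wedge₃_smul_left (c : ℂ) (X Y Z : L) :
    wedge₃ (c • X) Y Z = c • wedge₃ X Y Z := by
  have h := (exteriorPower.ιMulti ℂ 3 (M := L)).map_update_smul ![X, Y, Z] 0 c X
  rwa [update_vec₃_zero, update_vec₃_zero] at h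

theorem wedge₃_add_mid (X Y Z Y' : L) :
    wedge₃ X (Y + Y') Z = wedge₃ X Y Z + wedge₃ X Y' Z := by
  have h := (exteriorPower.ιMulti ℂ 3 (M := L)).map_update_add ![X, Y, Z] 1 Y Y'
  rwa [update_vec₃_one, update_vec₃_one, update_vec₃_one] at h

theorem wedge₃_smul_mid (c : ℂ) (X Y Z : L) :
    wedge₃ X (c • Y) Z = c • wedge₃ X Y Z := by
  have h := (exteriorPower.ιMulti ℂ 3 (M := L)).map_update_smul ![X, Y, Z] 1 c Y
  rwa [update_vec₃_one, update_vec₃_one] at h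

theorem wedge₃_add_right (X Y Z Z' : L) :
    wedge₃ X Y (Z + Z') = wedge₃ X Y Z + wedge₃ X Y Z' := by
  have h := (exteriorPower.ιMulti ℂ 3 (M := L)).map_update_add ![X, Y, Z] 2 Z Z'
  rwa [update_vec₃_two, update_vec₃_two, update_vec₃_two] at h

theorem wedge₃_smul_right (c : ℂ) (X Y Z : L) :
    wedge₃ X Y (c • Z) = c • wedge₃ X Y Z := by
  have h := (exteriorPower.ιMulti ℂ 3 (M := L)).map_update_smul ![X, Y, Z] 2 c Z
  rwa [update_vec₃_two, update_vec₃_two] at h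

/-- For fixed `X₁, X₂`, the Schouten bracket with `X₁ ∧ X₂` as an alternating map of `Y₁, Y₂`. -/
def schoutenRight (X : Fin 2 → L) : L [⋀^Fin 2]→ₗ[ℂ] ⋀[ℂ]^3 L where
  toFun Y := wedge₃ ⁅X 0, Y 0⁆ (X 1) (Y 1) - wedge₃ ⁅X 0, Y 1⁆ (X 1) (Y 0)
    - wedge₃ ⁅X 1, Y 0⁆ (X 0) (Y 1) + wedge₃ ⁅X 1, Y 1⁆ (X 0) (Y 0)
  map_update_add' := by
    intro dec Y i a b
    rw [Subsingleton.elim dec (instDecidableEqFin 2)]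
    fin_cases i <;>
      simp [wedge₃_add_left, wedge₃_add_right] <;> abel
  map_update_smul' := by
    intro dec Y i c a
    rw [Subsingleton.elim dec (instDecidableEqFin 2)]
    fin_cases i <;>
      simp [wedge₃_smul_left, wedge₃_smul_right, smul_sub, smul_add]
  map_eq_zero_of_eq' := by
    intro Y i j h hij
    have h01 : Y 0 = Y 1 := by
      fin_cases i <;> fin_cases j <;> simp_all
    rw [h01]
    abel

/-- The Schouten bracket of two bivectors as an alternating map of the first argument. -/
def schoutenAlt : L [⋀^Fin 2]→ₗ[ℂ] (⋀[ℂ]^2 L →ₗ[ℂ] ⋀[ℂ]^3 L) where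
  toFun X := exteriorPower.alternatingMapLinearEquiv (schoutenRight X)
  map_update_add' := by
    intro dec X i a b
    rw [Subsingleton.elim dec (instDecidableEqFin 2), ← map_add]
    congr 1
    ext Y
    fin_cases i <;>
      simp [schoutenRight, wedge₃_add_left, wedge₃_add_mid] <;> abel
  map_update_smul' := by
    intro dec X i c a
    rw [Subsingleton.elim dec (instDecidableEqFin 2), ← map_smul]
    congr 1
    ext Y
    fin_cases i <;>
      simp [schoutenRight, wedge₃_smul_left, wedge₃_smul_mid, smul_sub, smul_add]
  map_eq_zero_of_eq' := by
    intro X i j h hij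
    have h01 : X 0 = X 1 := by
      fin_cases i <;> fin_cases j <;> simp_all
    rw [← map_zero exteriorPower.alternatingMapLinearEquiv]
    congr 1
    ext Y
    simp [schoutenRight, h01]

/-- The Schouten bracket `⋀² L × ⋀² L → ⋀³ L`, that is, the bilinear map with
`⟦X₁ ∧ X₂, Y₁ ∧ Y₂⟧ = ∑ᵢⱼ (-1)^(i+j) [Xᵢ, Yⱼ] ∧ X_{3-i} ∧ Y_{3-j}`. -/
def schouten : ⋀[ℂ]^2 L →ₗ[ℂ] ⋀[ℂ]^2 L →ₗ[ℂ] ⋀[ℂ]^3 L :=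
  exteriorPower.alternatingMapLinearEquiv (R := ℂ) (M := L) (N := ⋀[ℂ]^2 L →ₗ[ℂ] ⋀[ℂ]^3 L)
    schoutenAlt

theorem schouten_wedge₂ (X₁ X₂ Y₁ Y₂ : L) :
    schouten (wedge₂ X₁ X₂) (wedge₂ Y₁ Y₂) =
      wedge₃ ⁅X₁, Y₁⁆ X₂ Y₂ - wedge₃ ⁅X₁, Y₂⁆ X₂ Y₁
        - wedge₃ ⁅X₂, Y₁⁆ X₁ Y₂ + wedge₃ ⁅X₂, Y₂⁆ X₁ Y₁ := by
  rw [schouten, wedge₂, exteriorPower.alternatingMapLinearEquiv_apply_ιMulti]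
  change exteriorPower.alternatingMapLinearEquiv (schoutenRight _) (wedge₂ Y₁ Y₂) = _
  rw [wedge₂, exteriorPower.alternatingMapLinearEquiv_apply_ιMulti]
  rfl

end Exterior

/-! ### Levi subalgebras and invariant tensors

Throughout, `L` is a complex simple Lie algebra `𝔤`, `H` a Cartan subalgebra `𝔥`, `b` a system of
simple roots `Π`, and `Γ` a set of simple roots. The orbit `M = G / G_Γ` enters through the tangent
space `𝔪 = 𝔪_Γ` at the base point: invariant polyvector fields on `M` are `𝔤_Γ`-invariant elements
of `⋀ 𝔪`. -/

variable {L : Type*} [LieRing L] [LieAlgebra ℂ L] [FiniteDimensional ℂ L]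
  [LieAlgebra.IsSimple ℂ L] {H : LieSubalgebra ℂ L} [H.IsCartanSubalgebra]

open LieAlgebra LieAlgebra.IsKilling LieModule

/-- The base `b` is of type `D_n` for some `n ≥ 4`, or of type `E₆`. -/
def IsTypeDOrE₆ (b : (rootSystem H).Base) : Prop :=
  (∃ n : ℕ, 4 ≤ n ∧ ∃ e : b.support ≃ Fin n,
    ∀ i j, b.cartanMatrix i j = CartanMatrix.D n (e i) (e j)) ∨
  (∃ e : b.support ≃ Fin 6,
    ∀ i j, b.cartanMatrix i j = CartanMatrix.E₆ (e i) (e j))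

/-- A choice of root vectors `E_α ∈ 𝔤_α` normalized by `(E_α, E_{-α}) = 1` for the Killing form.
(The value of `E` at the zero weight is irrelevant.) -/
structure RootVectors (H : LieSubalgebra ℂ L) [H.IsCartanSubalgebra] where
  E : Weight ℂ H L → L
  mem_rootSpace : ∀ α : Weight ℂ H L, α.IsNonZero → E α ∈ rootSpace H α
  killing_eq_one : ∀ α : Weight ℂ H L, α.IsNonZero → killingForm ℂ L (E α) (E (-α)) = 1

/-- `Ω_Γ`: the roots in the linear span of `Γ`. -/
def leviRoots (Γ : Finset H.root) : Set H.root :=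
  {α | (rootSystem H).root α ∈ Submodule.span ℂ ((rootSystem H).root '' (Γ : Set H.root))}

/-- The Levi subalgebra `𝔤_Γ`, generated by `𝔥` and the root spaces of `±α`, `α ∈ Γ`. -/
def levi (Γ : Finset H.root) : LieSubalgebra ℂ L :=
  LieSubalgebra.lieSpan ℂ L
    ({x | x ∈ H} ∪ {x | ∃ α ∈ Γ, x ∈ rootSpace H α.1 ∨ x ∈ rootSpace H (-α.1)})

/-- The `ad 𝔤_Γ`-invariant complement `𝔪 = 𝔪_Γ` of `𝔤_Γ`: the sum of the root spaces of the roots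
outside `Ω_Γ`. -/
def tangent (Γ : Finset H.root) : Submodule ℂ L :=
  ⨆ α : H.root, ⨆ _ : α ∉ leviRoots Γ, (rootSpace H α.1).toSubmodule

/-- `⋀ⁿ 𝔪` as a subspace of `⋀ⁿ 𝔤`. -/
def tangentPower (Γ : Finset H.root) (n : ℕ) : Submodule ℂ (⋀[ℂ]^n L) :=
  LinearMap.range (exteriorPower.map n (tangent Γ).subtype)

/-- `(⋀ⁿ 𝔪)^{𝔤_Γ}`: the invariant `n`-vector fields on the orbit. -/
def invariants (Γ : Finset H.root) (n : ℕ) : Submodule ℂ (⋀[ℂ]^n L) :=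
  tangentPower Γ n ⊓ ⨅ x : levi Γ, LinearMap.ker (adExt n (x : L))

/-- `θ` is a Cartan automorphism of `𝔤` (relative to `𝔥`): it acts on `𝔥` by `-1`, hence
interchanges the root spaces of `α` and `-α`. -/
def IsCartanAutomorphism (H : LieSubalgebra ℂ L) (θ : L ≃ₗ⁅ℂ⁆ L) : Prop :=
  ∀ x ∈ H, θ x = -x

/-- `(⋀ⁿ 𝔪)^{𝔤_Γ, θ}`: the elements of `⋀ⁿ 𝔪` that are invariant under `𝔤_Γ` and `θ`. -/
def thetaInvariants (Γ : Finset H.root) (θ : L ≃ₗ⁅ℂ⁆ L) (n : ℕ) : Submodule ℂ (⋀[ℂ]^n L) :=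
  invariants Γ n ⊓ LinearMap.eqLocus (exteriorPower.map n (θ : L →ₗ[ℂ] L)) LinearMap.id

/-! ### The three-vector `φ_M` and good orbits -/

/-- The projection of `𝔤` onto `𝔪` along `𝔤_Γ`, `x ↦ ∑ (x, E_{-α}) E_α` over the roots
`α ∉ Ω_Γ`. -/
def proj (R : RootVectors H) (Γ : Finset H.root) : L →ₗ[ℂ] L :=
  open Classical in
  ∑ α : H.root with α ∉ leviRoots Γ,
    (killingForm ℂ L (R.E (-α.1))).smulRight (R.E α.1)

/-- The Drinfeld-Jimbo `r`-matrix `r = ∑_{α > 0} E_α ∧ E_{-α}`. -/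
def rMatrix (R : RootVectors H) (b : (rootSystem H).Base) : ⋀[ℂ]^2 L :=
  open Classical in
  ∑ α : H.root with b.IsPos α, wedge₂ (R.E α.1) (R.E (-α.1))

/-- The invariant element `φ = ⟦r, r⟧ ∈ ⋀³ 𝔤`. -/
def phi (R : RootVectors H) (b : (rootSystem H).Base) : ⋀[ℂ]^3 L :=
  schouten (rMatrix R b) (rMatrix R b)

/-- `φ_M ∈ ⋀³ 𝔪`: the reduction of `φ` modulo `𝔤_Γ ∧ 𝔤 ∧ 𝔤`. -/
def phiM (R : RootVectors H) (b : (rootSystem H).Base) (Γ : Finset H.root) : ⋀[ℂ]^3 L :=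
  exteriorPower.map 3 (proj R Γ) (phi R b)

/-- The Schouten bracket on `M` of invariant bivector fields, as an element of `⋀³ 𝔪`: the reduction
of the Schouten bracket modulo `𝔤_Γ ∧ 𝔤 ∧ 𝔤`. -/
def schoutenM (R : RootVectors H) (Γ : Finset H.root) (v w : ⋀[ℂ]^2 L) : ⋀[ℂ]^3 L :=
  exteriorPower.map 3 (proj R Γ) (schouten v w)

/-- The Kirillov-Kostant-Souriau bivector `v_λ = ∑ (1 / λ(α)) E_α ∧ E_{-α}`, summed over
`α ∈ Ω⁺ ∖ Ω_Γ`, where `λ(α) = α(t)` for the element `t ∈ 𝔥` that corresponds to `λ` under the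
Killing form. -/
def kks (R : RootVectors H) (b : (rootSystem H).Base) (Γ : Finset H.root) (t : H) : ⋀[ℂ]^2 L :=
  open Classical in
  ∑ α : H.root with b.IsPos α ∧ α ∉ leviRoots Γ,
    (α.1 t)⁻¹ • wedge₂ (R.E α.1) (R.E (-α.1))

/-- `t ∈ 𝔥 ≅ 𝔥*` is a base point of an orbit whose stabilizer has Lie algebra `𝔤_Γ`: it is killed by
the roots of `Γ` and by no root outside `Ω_Γ`. -/
def IsBasePoint (Γ : Finset H.root) (t : H) : Prop :=
  (∀ α ∈ Γ, α.1 t = 0) ∧ ∀ α : H.root, α ∉ leviRoots Γ → α.1 t ≠ 0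

/-- The orbit `M = G / G_Γ`, realized as the orbit through `t`, is good: there is an invariant
bracket `f` with `⟦f, f⟧ = K² φ_M` for some `K ≠ 0`, compatible with the KKS bracket. -/
def IsGoodAt (R : RootVectors H) (b : (rootSystem H).Base) (Γ : Finset H.root) (t : H) : Prop :=
  ∃ f ∈ invariants Γ 2, ∃ K : ℂ, K ≠ 0 ∧
    schoutenM R Γ f f = K ^ 2 • phiM R b Γ ∧ schoutenM R Γ f (kks R b Γ t) = 0

/-- The homogeneous space `M = G / G_Γ` is good: one of its realizations as an orbit is good. -/
def IsGood (R : RootVectors H) (b : (rootSystem H).Base) (Γ : Finset H.root) : Prop :=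
  ∃ t : H, IsBasePoint Γ t ∧ IsGoodAt R b Γ t

/-- The orbit is a symmetric space: `[𝔪, 𝔪] ⊆ 𝔤_Γ`, that is, the linear map which is `1` on `𝔤_Γ`
and `-1` on `𝔪` is an automorphism of `𝔤`. -/
def IsSymmetricOrbit (Γ : Finset H.root) : Prop :=
  ∀ x ∈ tangent Γ, ∀ y ∈ tangent Γ, ⁅x, y⁆ ∈ levi Γ

end LieOrbit

end

/-! Contracting with root vectors under the Killing form turns a `𝔤_Γ`- and `θ`-invariant trivector
`w ∈ ⋀³ 𝔪` into a function on the triples of roots outside `Ω_Γ` with sum zero. Divided by the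
corresponding function of `φ_M`, which vanishes at no such triple, it becomes a function `ψ` that is
symmetric, constant along the moves `(x, y, z) ↦ (x + δ, y - δ, z)` by roots `δ ∈ Ω_Γ` and, since
`w` and `φ_M` are `θ`-invariant, unchanged under negation of the triple. It remains to connect all
triples.

An invariant bivector `f` acts on each root vector by a scalar `f(x)`. With `λ(x) = x(t)` and
`g(x) = λ(x)² f(x)`, the equations of a good orbit say that `g` is additive and that
`(g(x) λ(y) - g(y) λ(x))² = (K λ(x) λ(y) λ(x + y))²` whenever `x`, `y`, `x + y` are roots outside
`Ω_Γ`. This fails on a `D₄` subsystem all of whose relevant roots lie outside `Ω_Γ`: it would yield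
three signs that are pairwise opposite. In a star-shaped diagram it follows that at most two simple
roots lie outside `Γ`, both at ends of legs, and that they occur in positive roots with coefficients
`0` and `1` only. Triples of such levels are connected by moves, permutations and the sign change.
-/

noncomputable section

namespace LieOrbit

/-! ### Simply laced root systems with star-shaped diagrams -/

section Combinatorics

variable {V F : Type*} [AddCommGroup V] [Field F]

/-- `Φ` is a simply laced root system for the form `B`, normalized by `B x x = 2`. -/
structure IsSimplyLaced (Φ : Set V) (B : V →+ V →+ ℝ) : Prop where
  symm : ∀ x y, B x y = B y x
  self : ∀ x ∈ Φ, B x x = 2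
  neg_mem : ∀ x ∈ Φ, -x ∈ Φ
  cases : ∀ x ∈ Φ, ∀ y ∈ Φ, x = y ∨ x = -y ∨ B x y = -1 ∨ B x y = 0 ∨ B x y = 1
  add_mem : ∀ x ∈ Φ, ∀ y ∈ Φ, B x y = -1 → x + y ∈ Φ

namespace IsSimplyLaced

variable {Φ : Set V} {B : V →+ V →+ ℝ} (h : IsSimplyLaced Φ B)
include h

theorem sub_mem {x y : V} (hx : x ∈ Φ) (hy : y ∈ Φ) (hxy : B x y = 1) : x - y ∈ Φ := by
  rw [sub_eq_add_neg]
  exact h.add_mem _ hx _ (h.neg_mem _ hy) (by rw [map_neg, hxy])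

theorem eq_neg_one_of_add_mem {x y : V} (hx : x ∈ Φ) (hy : y ∈ Φ) (hxy : x + y ∈ Φ) :
    B x y = -1 := by
  have := h.self _ hxy
  simp only [map_add, AddMonoidHom.add_apply, h.self _ hx, h.self _ hy, h.symm y x] at this
  linarith

theorem eq_one_of_sub_mem {x y : V} (hx : x ∈ Φ) (hy : y ∈ Φ) (hxy : x - y ∈ Φ) :
    B x y = 1 := by
  have := h.eq_neg_one_of_add_mem hx (h.neg_mem _ hy) (by rwa [← sub_eq_add_neg])
  rwa [map_neg, neg_inj] at this

end IsSimplyLaced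

/-- The roots `r; y₁, y₂, y₃` are the simple roots of a subsystem of type `D₄` with center `r`. -/
structure IsD4 (Φ : Set V) (B : V →+ V →+ ℝ) (r y₁ y₂ y₃ : V) : Prop where
  mem : r ∈ Φ
  mem₁ : y₁ ∈ Φ
  mem₂ : y₂ ∈ Φ
  mem₃ : y₃ ∈ Φ
  adj₁ : B r y₁ = -1
  adj₂ : B r y₂ = -1
  adj₃ : B r y₃ = -1
  orth₁₂ : B y₁ y₂ = 0
  orth₁₃ : B y₁ y₃ = 0
  orth₂₃ : B y₂ y₃ = 0

namespace IsD4

variable {Φ : Set V} {B : V →+ V →+ ℝ} {r y₁ y₂ y₃ : V}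

theorem rotate (h : IsSimplyLaced Φ B) (d : IsD4 Φ B r y₁ y₂ y₃) : IsD4 Φ B r y₂ y₃ y₁ :=
  ⟨d.mem, d.mem₂, d.mem₃, d.mem₁, d.adj₂, d.adj₃, d.adj₁, d.orth₂₃,
    by rw [h.symm, d.orth₁₂], by rw [h.symm, d.orth₁₃]⟩

theorem add_mem (h : IsSimplyLaced Φ B) (d : IsD4 Φ B r y₁ y₂ y₃) : r + y₁ ∈ Φ :=
  h.add_mem _ d.mem _ d.mem₁ d.adj₁

theorem add_add_mem (h : IsSimplyLaced Φ B) (d : IsD4 Φ B r y₁ y₂ y₃) : r + y₁ + y₂ ∈ Φ :=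
  h.add_mem _ (d.add_mem h) _ d.mem₂ (by simp [d.adj₂, d.orth₁₂])

theorem add_add_add_mem (h : IsSimplyLaced Φ B) (d : IsD4 Φ B r y₁ y₂ y₃) :
    r + y₁ + y₂ + y₃ ∈ Φ :=
  h.add_mem _ (d.add_add_mem h) _ d.mem₃ (by simp [d.adj₃, d.orth₁₃, d.orth₂₃])

theorem highest_mem (h : IsSimplyLaced Φ B) (d : IsD4 Φ B r y₁ y₂ y₃) :
    r + y₁ + y₂ + y₃ + r ∈ Φ :=
  h.add_mem _ (d.add_add_add_mem h) _ d.mem (by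
    simp only [map_add, AddMonoidHom.add_apply, h.symm _ r, d.adj₁, d.adj₂, d.adj₃,
      h.self _ d.mem]
    norm_num)

/-- The same subsystem seen from the base whose center is an end of the given one. -/
theorem rebase (h : IsSimplyLaced Φ B) (d : IsD4 Φ B r y₁ y₂ y₃) :
    IsD4 Φ B y₁ r (r + y₂ + y₃) (-(r + y₁ + y₂)) := by
  have e₁ := h.self _ d.mem
  have e₂ := h.self _ d.mem₁
  have e₃ := h.self _ d.mem₂
  refine ⟨d.mem₁, d.mem, (d.rotate h).add_add_mem h, h.neg_mem _ (d.add_add_mem h), ?_, ?_, ?_, ?_,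
    ?_, ?_⟩ <;>
  simp only [map_add, map_neg, AddMonoidHom.add_apply, h.symm y₁ r, h.symm y₂ r, h.symm y₃ r,
    h.symm y₂ y₁, h.symm y₃ y₁, h.symm y₃ y₂, d.adj₁, d.adj₂, d.adj₃, d.orth₁₂, d.orth₁₃,
    d.orth₂₃, e₁, e₂, e₃] <;> norm_num

end IsD4

/-- The determinant of the values of `g` and `lam` at `x` and `y`. -/
def wronskian (lam g : V →+ F) (x y : V) : F := g x * lam y - g y * lam x

theorem wronskian_swap (lam g : V →+ F) (x y : V) :
    wronskian lam g y x = -wronskian lam g x y := by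
  simp only [wronskian]; ring

/-- The condition that a good orbit imposes on a pair of roots `x`, `y` with root sum `x + y`, in
terms of the functional `lam` of the base point and the functional `g` of the invariant bracket. -/
def IsCompatible (lam g : V →+ F) (K : F) (x y : V) : Prop :=
  wronskian lam g x y ^ 2 = (K * (lam x * lam y * lam (x + y))) ^ 2

theorem IsCompatible.symm {lam g : V →+ F} {K : F} {x y : V} (h : IsCompatible lam g K x y) :
    IsCompatible lam g K y x := by
  rw [IsCompatible, wronskian_swap, neg_sq, h, add_comm y x]
  ring

/-- The functionals `lam` and `g` are compatible at every pair of roots whose sum is a root. -/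
def IsGoodPair (Φ : Set V) (lam g : V →+ F) (K : F) : Prop :=
  ∀ x ∈ Φ, ∀ y ∈ Φ, x + y ∈ Φ → IsCompatible lam g K x y

/-- The functional `lam` does not vanish at the roots `r`, `r + yᵢ` and `r + yᵢ + yⱼ` of a subsystem
of type `D₄`. -/
structure IsD4Regular (lam : V →+ F) (r y₁ y₂ y₃ : V) : Prop where
  ne : lam r ≠ 0
  ne₁ : lam (r + y₁) ≠ 0
  ne₂ : lam (r + y₂) ≠ 0
  ne₃ : lam (r + y₃) ≠ 0
  ne₁₂ : lam (r + y₁ + y₂) ≠ 0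
  ne₂₃ : lam (r + y₂ + y₃) ≠ 0
  ne₃₁ : lam (r + y₃ + y₁) ≠ 0

theorem IsD4Regular.rotate {lam : V →+ F} {r y₁ y₂ y₃ : V} (s : IsD4Regular lam r y₁ y₂ y₃) :
    IsD4Regular lam r y₂ y₃ y₁ :=
  ⟨s.ne, s.ne₂, s.ne₃, s.ne₁, s.ne₂₃, s.ne₃₁, s.ne₁₂⟩

section D4

variable [CharZero F] {lam g : V →+ F} {K : F}

/-- The signs of the square roots of the first two conditions are opposite: equal signs are excluded
by the third condition. -/
theorem exists_sign_of_isCompatible {r y₁ y₂ : V} (hK : K ≠ 0) (h₀ : lam r ≠ 0)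
    (h₁ : lam (r + y₁) ≠ 0) (h₂ : lam (r + y₂) ≠ 0) (e₁ : IsCompatible lam g K r y₁)
    (e₂ : IsCompatible lam g K r y₂) (e₃ : IsCompatible lam g K (r + y₁) y₂) :
    ∃ k, k ^ 2 = K ^ 2 ∧ wronskian lam g r y₁ = k * (lam r * lam y₁ * lam (r + y₁)) ∧
      wronskian lam g r y₂ = -k * (lam r * lam y₂ * lam (r + y₂)) := by
  have key : ∀ k, k ^ 2 = K ^ 2 → wronskian lam g r y₁ = k * (lam r * lam y₁ * lam (r + y₁)) →
      wronskian lam g r y₂ = k * (lam r * lam y₂ * lam (r + y₂)) → lam y₂ = 0 ∨ lam y₁ = 0 := by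
    intro k hk f₁ f₂
    have hk0 : k ≠ 0 := by
      rintro rfl
      exact hK (by simpa using hk.symm)
    have f₃ : lam r * wronskian lam g (r + y₁) y₂ =
        k * lam r * lam y₂ * lam (r + y₁) * (lam r + lam y₂ - lam y₁) := by
      simp only [wronskian, map_add] at *
      linear_combination (-lam y₂) * f₁ + (lam r + lam y₁) * f₂
    have f₄ : (2 * (k * lam r * lam y₂ * lam (r + y₁))) ^ 2 * (lam y₁ * lam (r + y₂)) = 0 := by
      have f₃' := congrArg (· ^ 2) f₃
      simp only [IsCompatible, map_add] at *
      linear_combination f₃' - lam r ^ 2 * e₃ +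
        (lam r * ((lam r + lam y₁) * lam y₂ * (lam r + lam y₁ + lam y₂))) ^ 2 * hk
    simpa [hk0, h₀, h₁, h₂, -map_add] using f₄
  rcases sq_eq_sq_iff_eq_or_eq_neg.mp e₁ with f₁ | f₁ <;>
  rcases sq_eq_sq_iff_eq_or_eq_neg.mp e₂ with f₂ | f₂
  · rcases key K rfl f₁ f₂ with hz | hz
    · exact ⟨K, rfl, f₁, by simpa [hz] using f₂⟩
    · exact ⟨-K, by ring, by simpa [hz] using f₁, by rw [f₂]; ring⟩
  · exact ⟨K, rfl, f₁, by rw [f₂]; ring⟩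
  · exact ⟨-K, by ring, by rw [f₁]; ring, by rw [f₂]; ring⟩
  · rcases key (-K) (by ring) (by rw [f₁]; ring) (by rw [f₂]; ring) with hz | hz
    · exact ⟨-K, by ring, by rw [f₁]; ring, by simpa [hz] using f₂⟩
    · exact ⟨K, rfl, by simpa [hz] using f₁, by rw [f₂]; ring⟩

namespace IsD4

variable {Φ : Set V} {B : V →+ V →+ ℝ} {r y₁ y₂ y₃ : V} (h : IsSimplyLaced Φ B)
  (hK : K ≠ 0) (hC : IsGoodPair Φ lam g K)
include h hK hC

theorem exists_sign (d : IsD4 Φ B r y₁ y₂ y₃) (s : IsD4Regular lam r y₁ y₂ y₃) :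
    ∃ k, k ^ 2 = K ^ 2 ∧ wronskian lam g r y₁ = k * (lam r * lam y₁ * lam (r + y₁)) ∧
      wronskian lam g r y₂ = -k * (lam r * lam y₂ * lam (r + y₂)) :=
  exists_sign_of_isCompatible hK s.ne s.ne₁ s.ne₂ (hC _ d.mem _ d.mem₁ (d.add_mem h))
    (hC _ d.mem _ d.mem₂ ((d.rotate h).add_mem h))
    (hC _ (d.add_mem h) _ d.mem₂ (d.add_add_mem h))

theorem lam_ne_zero (d : IsD4 Φ B r y₁ y₂ y₃) (s : IsD4Regular lam r y₁ y₂ y₃) : lam y₁ ≠ 0 := by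
  intro hb
  have hq : g y₁ = 0 := by
    have := hC _ d.mem _ d.mem₁ (d.add_mem h)
    simpa [IsCompatible, wronskian, hb, s.ne] using this
  obtain ⟨k, hk, f₂, f₃⟩ := (d.rotate h).exists_sign h hK hC s.rotate
  have e := hC _ (d.add_add_add_mem h) _ d.mem (d.highest_mem h)
  have f : wronskian lam g (r + y₁ + y₂ + y₃) r =
      -(k * lam r * (lam y₂ - lam y₃) * lam (r + y₂ + y₃)) := by
    simp only [wronskian, map_add, hb, hq] at *
    linear_combination -f₂ - f₃
  have h4 : (2 * (K * lam r * lam (r + y₂ + y₃))) ^ 2 * (lam (r + y₂) * lam (r + y₃)) = 0 := by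
    rw [IsCompatible, f] at e
    simp only [map_add, hb] at *
    linear_combination -e + (lam r * (lam y₂ - lam y₃) * (lam r + lam y₂ + lam y₃)) ^ 2 * hk
  simp [hK, s.ne, s.ne₂, s.ne₃, s.ne₂₃, -map_add] at h4

/-- Three nonzero signs cannot be pairwise opposite. -/
theorem not_isD4Regular (d : IsD4 Φ B r y₁ y₂ y₃) : ¬ IsD4Regular lam r y₁ y₂ y₃ := by
  intro s
  have d' := d.rotate h
  have s' := s.rotate
  obtain ⟨k, hk, f₁, f₂⟩ := d.exists_sign h hK hC s
  obtain ⟨l, -, f₂', f₃⟩ := d'.exists_sign h hK hC s'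
  obtain ⟨m, -, f₃', f₁'⟩ := (d'.rotate h).exists_sign h hK hC s'.rotate
  have g₁ : k = -m := mul_right_cancel₀
    (mul_ne_zero (mul_ne_zero s.ne (d.lam_ne_zero h hK hC s)) s.ne₁) (f₁.symm.trans f₁')
  have g₂ : -k = l := mul_right_cancel₀
    (mul_ne_zero (mul_ne_zero s.ne (d'.lam_ne_zero h hK hC s')) s.ne₂) (f₂.symm.trans f₂')
  have g₃ : -l = m := mul_right_cancel₀
    (mul_ne_zero (mul_ne_zero s.ne ((d'.rotate h).lam_ne_zero h hK hC s'.rotate)) s.ne₃)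
    (f₃.symm.trans f₃')
  have hk0 : k = 0 := by
    have : 2 * k = 0 := by linear_combination g₁ - g₂ + g₃
    simpa using this
  rw [hk0] at hk
  exact hK (by simpa using hk.symm)

end IsD4

end D4

/-- `α` is a base of the root system `Φ`, with coordinate functions `c`. -/
structure IsBased {ι : Type*} (Φ : Set V) (α : ι → V) (c : ι → V →+ ℝ) : Prop where
  mem : ∀ i, α i ∈ Φ
  coord_self : ∀ i, c i (α i) = 1
  coord_ne : ∀ i j, i ≠ j → c i (α j) = 0
  induction : ∀ p : V → Prop, (∀ i, p (α i)) → (∀ x ∈ Φ, ∀ i, p x → x + α i ∈ Φ → p (x + α i)) →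
    ∀ x ∈ Φ, p x ∨ p (-x)

namespace IsBased

variable {ι : Type*} {Φ : Set V} {α : ι → V} {c : ι → V →+ ℝ} (hb : IsBased Φ α c)
include hb

theorem coord_nonneg (i j : ι) : 0 ≤ c i (α j) := by
  by_cases h : i = j
  · rw [h, hb.coord_self]; exact zero_le_one
  · rw [hb.coord_ne _ _ h]

theorem mem_closure_range {x : V} (hx : x ∈ Φ) : x ∈ AddSubgroup.closure (Set.range α) := by
  have hα : ∀ i, α i ∈ AddSubgroup.closure (Set.range α) :=
    fun i => AddSubgroup.subset_closure (Set.mem_range_self i)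
  have := hb.induction (· ∈ AddSubgroup.closure (Set.range α)) hα
    (fun x _ i hp _ => add_mem hp (hα i)) x hx
  rwa [neg_mem_iff, or_self] at this

theorem mem_closure_image {Γ : Set ι} {x : V} (hx : x ∈ AddSubgroup.closure (Set.range α))
    (h : ∀ i ∉ Γ, c i x = 0) : x ∈ AddSubgroup.closure (α '' Γ) := by
  classical
  obtain ⟨n, rfl⟩ := AddSubgroup.mem_closure_range_iff.mp hx
  refine AddSubgroup.sum_mem _ fun i _ => ?_
  by_cases hi : i ∈ Γ
  · exact AddSubgroup.zsmul_mem _ (AddSubgroup.subset_closure (Set.mem_image_of_mem α hi)) _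
  · have hn : n i = 0 := by
      have := h i hi
      rw [map_finsuppSum, Finsupp.sum, Finset.sum_eq_single i
        (fun j _ hj => by rw [map_zsmul, hb.coord_ne i j hj.symm, smul_zero])
        (fun hi' => by simp [Finsupp.notMem_support_iff.mp hi'])] at this
      simpa [hb.coord_self] using this
    simp only [hn, zero_smul, zero_mem]

theorem induction_of_coord_eq_zero {Γ : Set ι} {p : V → Prop} (simple : ∀ i ∈ Γ, p (α i))
    (neg : ∀ x, p (-x) → p x)
    (add : ∀ x ∈ Φ, ∀ i ∈ Γ, p x → x + α i ∈ Φ → p (x + α i)) {x : V} (hx : x ∈ Φ)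
    (h : ∀ i ∉ Γ, c i x = 0) : p x := by
  have mem_of_coord : ∀ i, (∀ j ∉ Γ, c j (α i) = 0) → i ∈ Γ := fun i h => by
    by_contra hi
    exact one_ne_zero ((hb.coord_self i).symm.trans (h i hi))
  have hpos_add : ∀ x i, (∀ j, 0 ≤ c j x) → ∀ j, 0 ≤ c j (x + α i) := fun x i hpos j => by
    rw [map_add]
    exact add_nonneg (hpos j) (hb.coord_nonneg j i)
  rcases hb.induction (fun x => (∀ i, 0 ≤ c i x) ∧ ((∀ i ∉ Γ, c i x = 0) → p x))
    (fun i => ⟨fun j => hb.coord_nonneg j i, fun h => simple i (mem_of_coord i h)⟩)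
    (fun x hx i ⟨hpos, ih⟩ hxi => ⟨hpos_add x i hpos, fun h => by
      have hzero : ∀ j ∉ Γ, c j x = 0 ∧ c j (α i) = 0 := fun j hj =>
        (add_eq_zero_iff_of_nonneg (hpos j) (hb.coord_nonneg j i)).1 (by rw [← map_add, h j hj])
      exact add x hx i (mem_of_coord i fun j hj => (hzero j hj).2)
        (ih fun j hj => (hzero j hj).1) hxi⟩) x hx with ⟨-, hp⟩ | ⟨-, hp⟩
  · exact hp h
  · exact neg x (hp fun i hi => by rw [map_neg, h i hi, neg_zero])

end IsBased

/-- The functionals `lam` and `g` vanish on the simple roots in `Γ`, and `lam` vanishes on no root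
outside the span of `Γ`. -/
structure IsAdapted {ι : Type*} (Φ : Set V) (α : ι → V) (c : ι → V →+ ℝ) (Γ : Set ι)
    (lam g : V →+ F) : Prop where
  lam_eq_zero : ∀ i ∈ Γ, lam (α i) = 0
  g_eq_zero : ∀ i ∈ Γ, g (α i) = 0
  lam_ne_zero : ∀ x ∈ Φ, ∀ i ∉ Γ, c i x ≠ 0 → lam x ≠ 0

/-- The Dynkin diagram of `A` is a star with three legs: `node k 0, …, node k (p k - 1)` are the
nodes of the leg `k`, counted from the center `o`. -/
structure IsStarShaped {ι : Type*} (A : Matrix ι ι ℤ) (o : ι) (p : Fin 3 → ℕ)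
    (node : Fin 3 → ℕ → ι) : Prop where
  isSymm : A.IsSymm
  pos : ∀ k, 0 < p k
  cover : ∀ i, i = o ∨ ∃ k, ∃ j < p k, i = node k j
  center_adj : ∀ k, A o (node k 0) = -1
  center_orth : ∀ k, ∀ j < p k, j ≠ 0 → A o (node k j) = 0
  leg_adj : ∀ k j, j + 1 < p k → A (node k j) (node k (j + 1)) = -1
  leg_orth : ∀ k i j, i + 1 < j → j < p k → A (node k i) (node k j) = 0
  orth : ∀ k l, k ≠ l → ∀ i < p k, ∀ j < p l, A (node k i) (node l j) = 0

section Adapted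

variable [CharZero F] {ι : Type*} {Φ : Set V} {B : V →+ V →+ ℝ} {α : ι → V} {c : ι → V →+ ℝ}
  {Γ : Set ι} {lam g : V →+ F} {K : F} (h : IsSimplyLaced Φ B) (hK : K ≠ 0)
  (hC : IsGoodPair Φ lam g K) (ha : IsAdapted Φ α c Γ lam g)

include h hK hC ha

theorem IsD4.mem_of_pos {r y₁ y₂ y₃ : V} (d : IsD4 Φ B r y₁ y₂ y₃) {i : ι} (hr : 0 < c i r)
    (h₁ : 0 ≤ c i y₁) (h₂ : 0 ≤ c i y₂) (h₃ : 0 ≤ c i y₃) : i ∈ Γ := by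
  by_contra hi
  have d' := d.rotate h
  have d'' := d'.rotate h
  have key : ∀ x ∈ Φ, 0 < c i x → lam x ≠ 0 := fun x hx hp => ha.lam_ne_zero x hx i hi hp.ne'
  refine d.not_isD4Regular h hK hC ⟨key _ d.mem hr, key _ (d.add_mem h) ?_,
    key _ (d'.add_mem h) ?_, key _ (d''.add_mem h) ?_, key _ (d.add_add_mem h) ?_,
    key _ (d'.add_add_mem h) ?_, key _ (d''.add_add_mem h) ?_⟩ <;>
  simp only [map_add] <;> linarith

/-- Apply `IsD4.not_isD4Regular` to the base `IsD4.rebase`. -/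
theorem IsD4.mem_or_mem_or_mem {r y₁ y₂ y₃ : V} (d : IsD4 Φ B r y₁ y₂ y₃) {i j k : ι}
    (hr : c i r = 0 ∧ c j r = 0 ∧ c k r = 0) (h₁ : c i y₁ ≠ 0 ∧ c j y₁ = 0 ∧ c k y₁ = 0)
    (h₂ : c i y₂ = 0 ∧ c j y₂ ≠ 0 ∧ c k y₂ = 0) (h₃ : c i y₃ = 0 ∧ c j y₃ = 0 ∧ c k y₃ ≠ 0) :
    i ∈ Γ ∨ j ∈ Γ ∨ k ∈ Γ := by
  by_contra! hcon
  obtain ⟨hi, hj, hk⟩ := hcon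
  have e := d.rebase h
  have e' := e.rotate h
  have e'' := e'.rotate h
  refine e.not_isD4Regular h hK hC ⟨ha.lam_ne_zero _ e.mem i hi h₁.1,
    ha.lam_ne_zero _ (e.add_mem h) i hi ?_, ha.lam_ne_zero _ (e'.add_mem h) i hi ?_,
    ha.lam_ne_zero _ (e''.add_mem h) j hj ?_, ha.lam_ne_zero _ (e.add_add_mem h) i hi ?_,
    ha.lam_ne_zero _ (e'.add_add_mem h) k hk ?_, ha.lam_ne_zero _ (e''.add_add_mem h) j hj ?_⟩ <;>
  simp [*]

end Adapted

theorem IsStarShaped.of_equiv {ι κ : Type*} {A : Matrix ι ι ℤ} {A' : Matrix κ κ ℤ} {o : ι}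
    {p : Fin 3 → ℕ} {node : Fin 3 → ℕ → ι} (hs : IsStarShaped A o p node) (e : κ ≃ ι)
    (hA : ∀ i j, A' i j = A (e i) (e j)) :
    IsStarShaped A' (e.symm o) p fun k j => e.symm (node k j) where
  isSymm := Matrix.IsSymm.ext fun i j => by rw [hA, hA, hs.isSymm.apply]
  pos := hs.pos
  cover i := by simpa only [Equiv.eq_symm_apply] using hs.cover (e i)
  center_adj := by simpa only [hA, Equiv.apply_symm_apply] using hs.center_adj
  center_orth := by simpa only [hA, Equiv.apply_symm_apply] using hs.center_orth
  leg_adj := by simpa only [hA, Equiv.apply_symm_apply] using hs.leg_adj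
  leg_orth := by simpa only [hA, Equiv.apply_symm_apply] using hs.leg_orth
  orth := by simpa only [hA, Equiv.apply_symm_apply] using hs.orth

theorem isStarShaped_D {m : ℕ} (hm : 1 ≤ m) :
    IsStarShaped (CartanMatrix.D (m + 3)) ⟨m, by omega⟩ ![m, 1, 1]
      ![fun j => ⟨m - 1 - j, by omega⟩, fun _ => ⟨m + 1, by omega⟩,
        fun _ => ⟨m + 2, by omega⟩] where
  isSymm := CartanMatrix.D_isSymm _
  pos := by simpa [Fin.forall_fin_succ, Nat.pos_iff_ne_zero] using Nat.one_le_iff_ne_zero.mp hm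
  cover i := by
    obtain ⟨i, hi⟩ := i
    simp only [Fin.exists_fin_succ, Fin.mk.injEq, Matrix.cons_val_zero, Matrix.cons_val_succ,
      IsEmpty.exists_iff, or_false]
    by_cases h : i < m
    · exact Or.inr (Or.inl ⟨m - 1 - i, by omega, by omega⟩)
    · have : i = m ∨ i = m + 1 ∨ i = m + 2 := by omega
      rcases this with rfl | rfl | rfl <;> simp
  center_adj k := by
    fin_cases k <;> simp [CartanMatrix.D]
    grind
  center_orth k j hj hj0 := by
    fin_cases k <;> simp at hj <;> simp [CartanMatrix.D] <;> grind
  leg_adj k j hj := by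
    fin_cases k <;> simp at hj
    simp [CartanMatrix.D]
    grind
  leg_orth k i j hij hj := by fin_cases k <;> simp at hj <;> simp [CartanMatrix.D] <;> grind
  orth k l hkl i hi j hj := by
    fin_cases k <;> fin_cases l <;> simp at hkl hi hj <;> simp [CartanMatrix.D] <;> grind

theorem isStarShaped_E₆ :
    IsStarShaped CartanMatrix.E₆ 3 ![1, 2, 2]
      ![fun _ => 1, fun j => if j = 0 then 2 else 0, fun j => if j = 0 then 4 else 5] where
  isSymm := CartanMatrix.E₆_isSymm
  pos := by decide
  cover := by decide
  center_adj := by decide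
  center_orth := by decide
  leg_adj k j hj := by
    have : (k = 1 ∨ k = 2) ∧ j = 0 := by fin_cases k <;> simp at hj ⊢ <;> omega
    obtain ⟨rfl | rfl, rfl⟩ := this <;> decide
  leg_orth k i j hi hj := by
    fin_cases k <;> simp at hj <;> omega
  orth := by decide

namespace IsStarShaped

variable {ι : Type*} {Φ : Set V} {B : V →+ V →+ ℝ} {α : ι → V} {c : ι → V →+ ℝ}
  {A : Matrix ι ι ℤ} {o : ι} {p : Fin 3 → ℕ} {node : Fin 3 → ℕ → ι}

/-- The sum of the first `t` simple roots on the leg `k`. -/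
def legSum (α : ι → V) (node : Fin 3 → ℕ → ι) (k : Fin 3) (t : ℕ) : V :=
  ∑ j ∈ Finset.range t, α (node k j)

section Form

variable (hs : IsStarShaped A o p node) (hA : ∀ i j, B (α i) (α j) = A i j)
include hs hA

theorem form_center_legSum (k : Fin 3) {t : ℕ} (ht : t < p k) :
    B (α o) (legSum α node k (t + 1)) = -1 := by
  rw [legSum, map_sum, Finset.sum_range_succ', hA, hs.center_adj, Finset.sum_eq_zero]
  · simp
  · intro j hj
    rw [hA, hs.center_orth k _ (by have := Finset.mem_range.mp hj; omega) j.succ_ne_zero,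
      Int.cast_zero]

theorem form_legSum_node (k : Fin 3) {t : ℕ} (ht : t + 1 < p k) :
    B (legSum α node k (t + 1)) (α (node k (t + 1))) = -1 := by
  rw [legSum, map_sum, AddMonoidHom.finsetSum_apply, Finset.sum_range_succ, hA, hs.leg_adj k t ht,
    Finset.sum_eq_zero]
  · simp
  · intro j hj
    rw [hA, hs.leg_orth k j _ (by have := Finset.mem_range.mp hj; omega) ht, Int.cast_zero]

theorem form_legSum_node_of_ne {k l : Fin 3} (hkl : k ≠ l) {t j : ℕ} (ht : t ≤ p k) (hj : j < p l) :
    B (legSum α node k t) (α (node l j)) = 0 := by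
  rw [legSum, map_sum, AddMonoidHom.finsetSum_apply]
  refine Finset.sum_eq_zero fun i hi => ?_
  rw [hA, hs.orth k l hkl i ((Finset.mem_range.mp hi).trans_le ht) j hj, Int.cast_zero]

theorem form_legSum_legSum {k l : Fin 3} (hkl : k ≠ l) {t u : ℕ} (ht : t ≤ p k) (hu : u ≤ p l) :
    B (legSum α node k t) (legSum α node l u) = 0 := by
  rw [legSum.eq_def α node l, map_sum]
  exact Finset.sum_eq_zero fun i hi =>
    hs.form_legSum_node_of_ne hA hkl ht ((Finset.mem_range.mp hi).trans_le hu)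

theorem form_center_add_legSum_node (k : Fin 3) {t : ℕ} (ht : t < p k) :
    B (α o + legSum α node k t) (α (node k t)) = -1 := by
  rw [map_add, AddMonoidHom.add_apply, hA]
  cases t with
  | zero => rw [hs.center_adj]; simp [legSum]
  | succ t =>
    rw [hs.center_orth k _ ht t.succ_ne_zero, hs.form_legSum_node hA k ht, Int.cast_zero, zero_add]

theorem form_center_add_legSum_node_zero {k l : Fin 3} (hkl : k ≠ l) {t : ℕ} (ht : t < p k) :
    B (α o + legSum α node k t) (α (node l 0)) = -1 := by
  rw [map_add, AddMonoidHom.add_apply, hA, hs.center_adj,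
    hs.form_legSum_node_of_ne hA hkl ht.le (hs.pos l)]
  simp

variable (h : IsSimplyLaced Φ B) (hb : IsBased Φ α c)
include h hb

theorem legSum_mem (k : Fin 3) {t : ℕ} (ht : t < p k) : legSum α node k (t + 1) ∈ Φ := by
  induction t with
  | zero => simpa [legSum] using hb.mem _
  | succ t ih =>
    rw [legSum, Finset.sum_range_succ]
    exact h.add_mem _ (ih (by omega)) _ (hb.mem _) (hs.form_legSum_node hA k ht)

theorem center_add_legSum_mem (k : Fin 3) {t : ℕ} (ht : t ≤ p k) :
    α o + legSum α node k t ∈ Φ := by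
  induction t with
  | zero => simpa [legSum] using hb.mem o
  | succ t ih =>
    rw [legSum, Finset.sum_range_succ, ← add_assoc]
    exact h.add_mem _ (ih (by omega)) _ (hb.mem _) (hs.form_center_add_legSum_node hA k ht)

theorem isD4_center_add_legSum (k : Fin 3) {t : ℕ} (ht : t < p k) :
    IsD4 Φ B (α o + legSum α node k t) (α (node k t)) (α (node (k + 1) 0))
      (α (node (k + 2) 0)) where
  mem := hs.center_add_legSum_mem hA h hb k ht.le
  mem₁ := hb.mem _
  mem₂ := hb.mem _
  mem₃ := hb.mem _
  adj₁ := hs.form_center_add_legSum_node hA k ht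
  adj₂ := hs.form_center_add_legSum_node_zero hA (by simp) ht
  adj₃ := hs.form_center_add_legSum_node_zero hA (by simp) ht
  orth₁₂ := by rw [hA, hs.orth _ _ (by simp) _ ht _ (hs.pos _), Int.cast_zero]
  orth₁₃ := by rw [hA, hs.orth _ _ (by simp) _ ht _ (hs.pos _), Int.cast_zero]
  orth₂₃ := by rw [hA, hs.orth _ _ (by simp) _ (hs.pos _) _ (hs.pos _), Int.cast_zero]

theorem isD4_center_legSum {t : Fin 3 → ℕ} (ht : ∀ k, t k < p k) :
    IsD4 Φ B (α o) (legSum α node 0 (t 0 + 1)) (legSum α node 1 (t 1 + 1))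
      (legSum α node 2 (t 2 + 1)) where
  mem := hb.mem o
  mem₁ := hs.legSum_mem hA h hb 0 (ht 0)
  mem₂ := hs.legSum_mem hA h hb 1 (ht 1)
  mem₃ := hs.legSum_mem hA h hb 2 (ht 2)
  adj₁ := hs.form_center_legSum hA 0 (ht 0)
  adj₂ := hs.form_center_legSum hA 1 (ht 1)
  adj₃ := hs.form_center_legSum hA 2 (ht 2)
  orth₁₂ := hs.form_legSum_legSum hA (by decide) (ht 0) (ht 1)
  orth₁₃ := hs.form_legSum_legSum hA (by decide) (ht 0) (ht 2)
  orth₂₃ := hs.form_legSum_legSum hA (by decide) (ht 1) (ht 2)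

omit hb in
theorem node_ne_node (hα : ∀ i, α i ∈ Φ) {k l : Fin 3} (hkl : k ≠ l) {i j : ℕ} (hi : i < p k)
    (hj : j < p l) : node k i ≠ node l j := by
  intro e
  have := h.self _ (hα (node k i))
  rw [hA] at this
  nth_rewrite 2 [e] at this
  rw [hs.orth k l hkl i hi j hj] at this
  norm_num at this

omit hb in
theorem node_ne_center (hα : ∀ i, α i ∈ Φ) (k : Fin 3) {j : ℕ} (hj : j < p k) : node k j ≠ o := by
  intro e
  have := h.self _ (hα o)
  rw [hA] at this
  nth_rewrite 2 [← e] at this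
  rcases eq_or_ne j 0 with rfl | hj0
  · rw [hs.center_adj] at this
    norm_num at this
  · rw [hs.center_orth k j hj hj0] at this
    norm_num at this

theorem coord_legSum_of_ne {k l : Fin 3} (hkl : k ≠ l) {i t : ℕ} (hi : i < p k) (ht : t ≤ p l) :
    c (node k i) (legSum α node l t) = 0 := by
  rw [legSum, map_sum]
  exact Finset.sum_eq_zero fun j hj => hb.coord_ne _ _
    (hs.node_ne_node hA h hb.mem hkl hi ((Finset.mem_range.mp hj).trans_le ht))

end Form

theorem coord_legSum_nonneg (hb : IsBased Φ α c) (i : ι) (k : Fin 3) (t : ℕ) :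
    0 ≤ c i (legSum α node k t) := by
  rw [legSum, map_sum]
  exact Finset.sum_nonneg fun j _ => hb.coord_nonneg _ _

theorem coord_legSum_pos (hb : IsBased Φ α c) (k : Fin 3) (t : ℕ) :
    0 < c (node k t) (legSum α node k (t + 1)) := by
  rw [legSum, Finset.sum_range_succ, map_add, hb.coord_self]
  exact add_pos_of_nonneg_of_pos (coord_legSum_nonneg hb _ _ _) one_pos

section Adapted

variable [CharZero F] {Γ : Set ι} {lam g : V →+ F} {K : F}
  (hs : IsStarShaped A o p node) (hA : ∀ i j, B (α i) (α j) = A i j) (h : IsSimplyLaced Φ B)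
  (hb : IsBased Φ α c) (hK : K ≠ 0) (hC : IsGoodPair Φ lam g K) (ha : IsAdapted Φ α c Γ lam g)
include hs hA h hb hK hC ha

theorem center_mem : o ∈ Γ :=
  (hs.isD4_center_add_legSum hA h hb 0 (hs.pos 0)).mem_of_pos h hK hC ha
    (by simp [legSum, hb.coord_self]) (hb.coord_nonneg _ _) (hb.coord_nonneg _ _)
    (hb.coord_nonneg _ _)

theorem node_mem (k : Fin 3) {t : ℕ} (ht : t + 1 < p k) : node k t ∈ Γ :=
  (hs.isD4_center_add_legSum hA h hb k ht).mem_of_pos h hK hC ha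
    (by
      rw [map_add]
      exact add_pos_of_nonneg_of_pos (hb.coord_nonneg _ _) (coord_legSum_pos hb k t))
    (hb.coord_nonneg _ _) (hb.coord_nonneg _ _) (hb.coord_nonneg _ _)

theorem exists_end_mem : ∃ k, node k (p k - 1) ∈ Γ := by
  have ht : ∀ k, p k - 1 < p k := fun k => Nat.sub_one_lt (hs.pos k).ne'
  have center : ∀ k, c (node k (p k - 1)) (α o) = 0 := fun k =>
    hb.coord_ne _ _ (hs.node_ne_center hA h hb.mem k (ht k))
  have self : ∀ k, c (node k (p k - 1)) (legSum α node k (p k - 1 + 1)) ≠ 0 := fun k =>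
    (coord_legSum_pos hb k _).ne'
  have ne : ∀ k l, k ≠ l → c (node k (p k - 1)) (legSum α node l (p l - 1 + 1)) = 0 :=
    fun k l hkl => hs.coord_legSum_of_ne hA h hb hkl (ht k) (ht l)
  rcases (hs.isD4_center_legSum hA h hb ht).mem_or_mem_or_mem h hK hC ha
    ⟨center 0, center 1, center 2⟩
    ⟨self 0, ne 1 0 (by decide), ne 2 0 (by decide)⟩
    ⟨ne 0 1 (by decide), self 1, ne 2 1 (by decide)⟩
    ⟨ne 0 2 (by decide), ne 1 2 (by decide), self 2⟩ with e | e | e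
  exacts [⟨0, e⟩, ⟨1, e⟩, ⟨2, e⟩]

/-- The simple roots outside `Γ` are ends of legs, and not all three ends are outside `Γ`. -/
theorem exists_pair_of_notMem : ∃ j k, j ≠ k ∧ ∀ i ∉ Γ, i = j ∨ i = k := by
  obtain ⟨k, hk⟩ := hs.exists_end_mem hA h hb hK hC ha
  have ht : ∀ k, p k - 1 < p k := fun k => Nat.sub_one_lt (hs.pos k).ne'
  refine ⟨node (k + 1) (p (k + 1) - 1), node (k + 2) (p (k + 2) - 1),
    hs.node_ne_node hA h hb.mem (by simp) (ht _) (ht _), fun i hi => ?_⟩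
  rcases hs.cover i with rfl | ⟨l, j, hj, rfl⟩
  · exact absurd (hs.center_mem hA h hb hK hC ha) hi
  have hend : j = p l - 1 := by
    by_contra hne
    exact hi (hs.node_mem hA h hb hK hC ha l (by omega))
  subst hend
  have hl : l ≠ k := fun e => hi (e ▸ hk)
  have fin_cases : ∀ k l : Fin 3, l ≠ k → l = k + 1 ∨ l = k + 2 := by decide
  exact (fin_cases k l hl).imp (fun e => by rw [e]) (fun e => by rw [e])

end Adapted

end IsStarShaped

/-- The levels occurring among the positive roots with respect to generators of levels `e`, `f`. -/
def IsSmallLevel {M : Type*} [AddCommGroup M] (e f u : M) : Prop :=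
  u = 0 ∨ u = e ∨ u = f ∨ u = e + f

section Levels

variable {M : Type*} [AddCommGroup M] {Lam G : M →+ F} {K : F} {e f : M}

/-- The part of `IsSmallLevel` that propagates along sums of simple roots: compatibility at `(e, f)`
is recorded when the level `e + f` is reached, and later excludes `2 e + f` and `e + 2 f`. -/
def IsReachedLevel (Lam G : M →+ F) (K : F) (e f u : M) : Prop :=
  u = 0 ∨ u = e ∨ u = f ∨ u = e + f ∧ IsCompatible Lam G K e f

theorem IsReachedLevel.symm {u : M} (h : IsReachedLevel Lam G K e f u) :
    IsReachedLevel Lam G K f e u := by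
  rcases h with h | h | h | ⟨h, hc⟩
  · exact Or.inl h
  · exact Or.inr (Or.inr (Or.inl h))
  · exact Or.inr (Or.inl h)
  · exact Or.inr (Or.inr (Or.inr ⟨h.trans (add_comm _ _), hc.symm⟩))

theorem IsReachedLevel.isSmallLevel {u : M} (h : IsReachedLevel Lam G K e f u) :
    IsSmallLevel e f u :=
  h.imp_right (Or.imp_right (Or.imp_right And.left))

variable [CharZero F]

theorem not_isCompatible_self (hK : K ≠ 0) (he : Lam e ≠ 0) : ¬ IsCompatible Lam G K e e := by
  intro h
  have h₁ : (2 * (K * Lam e * Lam e * Lam e)) ^ 2 = 0 := by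
    simp only [IsCompatible, wronskian, map_add] at h
    linear_combination -h
  simp [hK, he] at h₁

theorem not_isCompatible_add_of_isCompatible (hK : K ≠ 0) (he : Lam e ≠ 0) (hef : Lam (e + f) ≠ 0)
    (h : IsCompatible Lam G K e f) : ¬ IsCompatible Lam G K (e + f) e := by
  intro h'
  have h₁ : (2 * (K * Lam e * Lam (e + f))) ^ 2 * (Lam e * Lam (e + f)) = 0 := by
    simp only [IsCompatible, wronskian, map_add] at h h' ⊢
    linear_combination h - h'
  simp [hK, he, hef, -map_add] at h₁

theorem IsReachedLevel.add {u : M} (hK : K ≠ 0) (he : Lam e ≠ 0) (hu : u = e + f → Lam u ≠ 0)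
    (h : IsReachedLevel Lam G K e f u) (hue : IsCompatible Lam G K u e) :
    IsReachedLevel Lam G K e f (u + e) := by
  rcases h with rfl | rfl | rfl | ⟨rfl, hc⟩
  · exact Or.inr (Or.inl (zero_add e))
  · exact absurd hue (not_isCompatible_self hK he)
  · exact Or.inr (Or.inr (Or.inr ⟨add_comm _ _, hue.symm⟩))
  · exact absurd hue (not_isCompatible_add_of_isCompatible hK he (hu rfl) hc)

theorem isSmallLevel_or_neg {ι : Type*} {Φ : Set V} {α : ι → V} {c : ι → V →+ ℝ} {l : V →+ M}
    (hb : IsBased Φ α c) (hK : K ≠ 0) (he : e ≠ 0) (hf : f ≠ 0) (hef : e + f ≠ 0)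
    (hl : ∀ i, l (α i) = 0 ∨ l (α i) = e ∨ l (α i) = f) (hLam : ∀ x ∈ Φ, l x ≠ 0 → Lam (l x) ≠ 0)
    (hC : ∀ x ∈ Φ, ∀ y ∈ Φ, x + y ∈ Φ → IsCompatible Lam G K (l x) (l y)) {x : V} (hx : x ∈ Φ) :
    IsSmallLevel e f (l x) ∨ IsSmallLevel e f (l (-x)) := by
  have main := hb.induction (fun x => IsReachedLevel Lam G K e f (l x))
    (fun i => (hl i).imp_right (Or.imp_right Or.inl)) (fun x hx i hpx hxi => ?_) x hx
  · exact main.imp IsReachedLevel.isSmallLevel IsReachedLevel.isSmallLevel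
  have hCi := hC x hx _ (hb.mem i) hxi
  have hLi := hLam _ (hb.mem i)
  rw [map_add]
  rcases hl i with h | h | h <;> rw [h] at hCi hLi ⊢
  · rwa [add_zero]
  · exact hpx.add hK (hLi he) (fun hu => hLam x hx (hu ▸ hef)) hCi
  · exact (hpx.symm.add hK (hLi hf) (fun hu => hLam x hx (hu ▸ add_comm e f ▸ hef)) hCi).symm

end Levels

/-- Three roots with sum zero, none of which has level zero. -/
structure IsTriple {M : Type*} [AddCommGroup M] (Φ : Set V) (l : V →+ M) (x y z : V) : Prop where
  mem₁ : x ∈ Φ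
  mem₂ : y ∈ Φ
  mem₃ : z ∈ Φ
  sum : x + y + z = 0
  level₁ : l x ≠ 0
  level₂ : l y ≠ 0
  level₃ : l z ≠ 0

/-- A function on triples of roots that is symmetric, even, and constant along the moves
`(x, y, z) ↦ (x + δ, y - δ, z)` by roots `δ` of level zero. -/
structure IsMoveInvariant {M β : Type*} [AddCommGroup M] (Φ : Set V) (l : V →+ M)
    (ψ : V → V → V → β) : Prop where
  rotate : ∀ x y z, IsTriple Φ l x y z → ψ y z x = ψ x y z
  swap : ∀ x y z, IsTriple Φ l x y z → ψ y x z = ψ x y z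
  neg : ∀ x y z, IsTriple Φ l x y z → ψ (-x) (-y) (-z) = ψ x y z
  move : ∀ x y z, IsTriple Φ l x y z → ∀ δ ∈ Φ, l δ = 0 → x + δ ∈ Φ → y - δ ∈ Φ →
    ψ (x + δ) (y - δ) z = ψ x y z

/-- A triple of roots of levels `(1, 0)`, `(0, 1)` and `(-1, -1)`. -/
structure IsStandardTriple (Φ : Set V) (l : V →+ ℝ × ℝ) (x y z : V) : Prop where
  mem₁ : x ∈ Φ
  mem₂ : y ∈ Φ
  mem₃ : z ∈ Φ
  sum : x + y + z = 0
  level₁ : l x = (1, 0)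
  level₂ : l y = (0, 1)

section Triples

variable {Φ : Set V} {B : V →+ V →+ ℝ} {x y z : V}

namespace IsTriple

variable {M : Type*} [AddCommGroup M] {l : V →+ M}

theorem rotate (t : IsTriple Φ l x y z) : IsTriple Φ l y z x :=
  ⟨t.mem₂, t.mem₃, t.mem₁, by rw [← t.sum]; abel, t.level₂, t.level₃, t.level₁⟩

theorem swap (t : IsTriple Φ l x y z) : IsTriple Φ l y x z :=
  ⟨t.mem₂, t.mem₁, t.mem₃, by rw [← t.sum]; abel, t.level₂, t.level₁, t.level₃⟩

theorem neg (h : IsSimplyLaced Φ B) (t : IsTriple Φ l x y z) : IsTriple Φ l (-x) (-y) (-z) :=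
  ⟨h.neg_mem _ t.mem₁, h.neg_mem _ t.mem₂, h.neg_mem _ t.mem₃,
    by rw [← neg_zero, ← t.sum]; abel, by simpa using t.level₁, by simpa using t.level₂,
    by simpa using t.level₃⟩

theorem sub_add {δ : V} (t : IsTriple Φ l x y z) (hx : x - δ ∈ Φ) (hz : z + δ ∈ Φ)
    (hl : l δ = 0) : IsTriple Φ l (x - δ) y (z + δ) :=
  ⟨hx, t.mem₂, hz, by rw [← t.sum]; abel, by simpa [hl] using t.level₁, t.level₂,
    by simpa [hl] using t.level₃⟩

theorem form_third (h : IsSimplyLaced Φ B) (t : IsTriple Φ l x y z) : B x z = -1 := by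
  refine h.eq_neg_one_of_add_mem t.mem₁ t.mem₃ ?_
  have hy : x + z = -y := by rw [eq_neg_iff_add_eq_zero, ← t.sum]; abel
  exact hy ▸ h.neg_mem _ t.mem₂

theorem form_eq (h : IsSimplyLaced Φ B) (t : IsTriple Φ l x y z) {δ : V} (hδ : δ ∈ Φ)
    (hl : l δ = 0) : B x δ = -1 ∨ B x δ = 0 ∨ B x δ = 1 := by
  rcases h.cases x t.mem₁ δ hδ with rfl | rfl | e
  · exact absurd hl t.level₁
  · exact absurd (by rw [map_neg, hl, neg_zero]) t.level₁
  · exact e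

end IsTriple

section Move

variable {M β : Type*} [AddCommGroup M] {l : V →+ M} {ψ : V → V → V → β} {δ : V}

theorem IsMoveInvariant.move_first_third (hψ : IsMoveInvariant Φ l ψ) (t : IsTriple Φ l x y z)
    (hδ : δ ∈ Φ) (hl : l δ = 0) (hx : x - δ ∈ Φ) (hz : z + δ ∈ Φ) :
    ψ (x - δ) y (z + δ) = ψ x y z := by
  have t' := t.sub_add hx hz hl
  rw [hψ.rotate _ _ _ t'.rotate.rotate, hψ.rotate _ _ _ t.rotate.rotate]
  exact hψ.move _ _ _ t.rotate.rotate δ hδ hl hz hx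

end Move

namespace IsStandardTriple

variable {l : V →+ ℝ × ℝ}

theorem level₃ (t : IsStandardTriple Φ l x y z) : l z = (-1, -1) := by
  have : l x + l y + l z = 0 := by rw [← map_add, ← map_add, t.sum, map_zero]
  rw [eq_neg_of_add_eq_zero_right this, t.level₁, t.level₂]
  norm_num

theorem isTriple (t : IsStandardTriple Φ l x y z) : IsTriple Φ l x y z :=
  ⟨t.mem₁, t.mem₂, t.mem₃, t.sum, by simp [t.level₁], by simp [t.level₂], by simp [t.level₃]⟩

end IsStandardTriple

theorem IsTriple.isStandardTriple_or_swap {l : V →+ ℝ × ℝ} (t : IsTriple Φ l x y z)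
    (hx : IsSmallLevel (1, 0) (0, 1) (l x)) (hy : IsSmallLevel (1, 0) (0, 1) (l y))
    (hz : IsSmallLevel (1, 0) (0, 1) (l z) ∨ IsSmallLevel (1, 0) (0, 1) (l (-z))) :
    IsStandardTriple Φ l x y z ∨ IsStandardTriple Φ l y x z := by
  have hsum : l z = -(l x + l y) := by
    rw [← map_add, ← map_neg, eq_neg_of_add_eq_zero_right t.sum]
  rw [map_neg, hsum, neg_neg] at hz
  rcases hx.resolve_left t.level₁ with ex | ex | ex <;>
  rcases hy.resolve_left t.level₂ with ey | ey | ey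
  case inr.inl.inl => exact Or.inr ⟨t.mem₂, t.mem₁, t.mem₃, t.swap.sum, ey, ex⟩
  case inl.inr.inl => exact Or.inl ⟨t.mem₁, t.mem₂, t.mem₃, t.sum, ex, ey⟩
  all_goals
    rw [ex, ey] at hz
    norm_num [IsSmallLevel] at hz

variable {β : Type*} {l : V →+ ℝ × ℝ} {ψ : V → V → V → β} (h : IsSimplyLaced Φ B)
  (hlev : ∀ x ∈ Φ, IsSmallLevel (1, 0) (0, 1) (l x) ∨ IsSmallLevel (1, 0) (0, 1) (l (-x)))
  (hψ : IsMoveInvariant Φ l ψ)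
include h hlev hψ

theorem IsTriple.exists_isStandardTriple (t : IsTriple Φ l x y z) :
    ∃ x' y' z', IsStandardTriple Φ l x' y' z' ∧ ψ x y z = ψ x' y' z' := by
  have pos : ∀ {x y z}, IsTriple Φ l x y z → IsSmallLevel (1, 0) (0, 1) (l x) →
      IsSmallLevel (1, 0) (0, 1) (l y) →
      ∃ x' y' z', IsStandardTriple Φ l x' y' z' ∧ ψ x y z = ψ x' y' z' := by
    intro x y z t hx hy
    rcases t.isStandardTriple_or_swap hx hy (hlev z t.mem₃) with s | s
    · exact ⟨_, _, _, s, rfl⟩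
    · exact ⟨_, _, _, s, (hψ.swap _ _ _ t).symm⟩
  have neg : ∀ {x y z}, IsTriple Φ l x y z → IsSmallLevel (1, 0) (0, 1) (l (-x)) →
      IsSmallLevel (1, 0) (0, 1) (l (-y)) →
      ∃ x' y' z', IsStandardTriple Φ l x' y' z' ∧ ψ x y z = ψ x' y' z' := by
    intro x y z t hx hy
    rw [← hψ.neg _ _ _ t]
    exact pos (t.neg h) hx hy
  have rot := hψ.rotate _ _ _ t
  have rot' := (hψ.rotate _ _ _ t.rotate).trans rot
  rcases hlev x t.mem₁ with hx | hx <;> rcases hlev y t.mem₂ with hy | hy <;>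
  rcases hlev z t.mem₃ with hz | hz
  · exact pos t hx hy
  · exact pos t hx hy
  · exact rot' ▸ pos t.rotate.rotate hz hx
  · exact rot ▸ neg t.rotate hy hz
  · exact rot ▸ pos t.rotate hy hz
  · exact rot' ▸ neg t.rotate.rotate hz hx
  · exact neg t hx hy
  · exact neg t hx hy

namespace IsStandardTriple

omit hψ in
theorem form_eq_one {x₀ y₀ : V} (t : IsStandardTriple Φ l x y z)
    (t₀ : IsStandardTriple Φ l x₀ y₀ z) (hne : x ≠ x₀) : B x x₀ = 1 := by
  have hxz₀ := t₀.isTriple.form_third h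
  rcases h.cases x t.mem₁ x₀ t₀.mem₁ with e | e | e | e | e
  · exact absurd e hne
  · have e' := congrArg l e
    rw [map_neg, t.level₁, t₀.level₁] at e'
    norm_num at e'
  · have := hlev _ (h.add_mem _ t.mem₁ _ t₀.mem₁ e)
    rw [map_neg, map_add, t.level₁, t₀.level₁] at this
    norm_num [IsSmallLevel] at this
  · have hy : y = -x - z := by rw [eq_sub_iff_add_eq, eq_neg_iff_add_eq_zero, ← t.sum]; abel
    have := hlev _ (h.sub_mem t₀.mem₁ t.mem₂ (by
      rw [hy, map_sub, map_neg, hxz₀, h.symm, e]; norm_num))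
    rw [map_neg, map_sub, t₀.level₁, t.level₂] at this
    norm_num [IsSmallLevel] at this
  · exact e

theorem eq_of_third_eq {x₀ y₀ : V} (t : IsStandardTriple Φ l x y z)
    (t₀ : IsStandardTriple Φ l x₀ y₀ z) : ψ x y z = ψ x₀ y₀ z := by
  have hy : y₀ = y - (x₀ - x) := by
    rw [eq_sub_iff_add_eq, ← add_sub_assoc, add_comm y₀,
      ← add_right_cancel (t.sum.trans t₀.sum.symm), add_sub_cancel_left]
  by_cases hx : x = x₀
  · rw [hy, hx, sub_self, sub_zero]
  have hδ := h.sub_mem t₀.mem₁ t.mem₁ ((h.symm _ _).trans (t.form_eq_one h hlev t₀ hx))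
  have := hψ.move x y z t.isTriple (x₀ - x) hδ (by rw [map_sub, t.level₁, t₀.level₁, sub_self])
    (by rw [add_sub_cancel]; exact t₀.mem₁) (hy ▸ t₀.mem₂)
  rw [← this, add_sub_cancel, hy]

omit hlev in
theorem exists_add_third {δ : V} (t : IsStandardTriple Φ l x y z) (hδ : δ ∈ Φ) (hl : l δ = 0)
    (hz : B z δ < 0) :
    ∃ x' y', IsStandardTriple Φ l x' y' (z + δ) ∧ ψ x' y' (z + δ) = ψ x y z := by
  have t' := t.isTriple
  have hzδ : z + δ ∈ Φ := h.add_mem _ t.mem₃ _ hδ (by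
    rcases t'.rotate.rotate.form_eq h hδ hl with e | e | e <;> linarith)
  have hsum : B x δ + B y δ + B z δ = 0 := by
    rw [← AddMonoidHom.add_apply, ← AddMonoidHom.add_apply, ← map_add, ← map_add, t.sum, map_zero,
      AddMonoidHom.zero_apply]
  have hor : B x δ = 1 ∨ B y δ = 1 := by
    rcases t'.form_eq h hδ hl with e | e | e <;>
    rcases t'.rotate.form_eq h hδ hl with e' | e' | e' <;>
    first | exact Or.inl e | exact Or.inr e' | linarith
  rcases hor with e | e
  · have hx := h.sub_mem t.mem₁ hδ e
    exact ⟨x - δ, y, ⟨hx, t.mem₂, hzδ, (t'.sub_add hx hzδ hl).sum, by simp [hl, t.level₁],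
      t.level₂⟩, hψ.move_first_third t' hδ hl hx hzδ⟩
  · have hy := h.sub_mem t.mem₂ hδ e
    have s := t'.swap.sub_add hy hzδ hl
    refine ⟨x, y - δ, ⟨t.mem₁, hy, hzδ, s.swap.sum, t.level₁, by simp [hl, t.level₂]⟩, ?_⟩
    rw [hψ.swap _ _ _ s, hψ.move_first_third t'.swap hδ hl hy hzδ, hψ.swap _ _ _ t']

omit hlev hψ in
theorem form_sub_third_neg {x₀ y₀ z₀ : V} (t : IsStandardTriple Φ l x y z)
    (t₀ : IsStandardTriple Φ l x₀ y₀ z₀) (hne : z ≠ z₀) : B z (z₀ - z) < 0 := by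
  rw [map_sub, h.self z t.mem₃]
  rcases h.cases z t.mem₃ z₀ t₀.mem₃ with e | e | e | e | e
  · exact absurd e hne
  · rw [← neg_eq_iff_eq_neg.mpr e, map_neg, h.self z t.mem₃]
    norm_num
  all_goals rw [e]; norm_num

theorem eq_of_multiset_sum {x₀ y₀ z₀ : V} (t₀ : IsStandardTriple Φ l x₀ y₀ z₀) (s : Multiset V)
    (hs : ∀ δ ∈ s, δ ∈ Φ ∧ l δ = 0) (t : IsStandardTriple Φ l x y z) (hz : z₀ - z = s.sum) :
    ψ x y z = ψ x₀ y₀ z₀ := by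
  classical
  induction s using Multiset.strongInductionOn generalizing x y z with | _ s ih
  by_cases hne : z = z₀
  · subst hne
    exact t.eq_of_third_eq h hlev hψ t₀
  obtain ⟨δ, hδs, hδ⟩ : ∃ δ ∈ s, B z δ < 0 := by
    by_contra! hcon
    have hneg := t.form_sub_third_neg h t₀ hne
    rw [hz, map_multiset_sum] at hneg
    exact hneg.not_ge (Multiset.sum_nonneg (by simpa using hcon))
  obtain ⟨x', y', t', e⟩ := t.exists_add_third h hψ (hs δ hδs).1 (hs δ hδs).2 hδ
  rw [← e]
  refine ih _ (Multiset.erase_lt.mpr hδs)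
    (fun δ' hδ' => hs δ' (Multiset.mem_of_mem_erase hδ')) t' ?_
  rw [← Multiset.cons_erase hδs, Multiset.sum_cons] at hz
  rw [← sub_sub, hz, add_sub_cancel_left]

end IsStandardTriple

theorem IsMoveInvariant.exists_const [Nonempty β]
    (hcl : ∀ x ∈ Φ, ∀ y ∈ Φ, l x = l y → x - y ∈ AddSubgroup.closure {δ | δ ∈ Φ ∧ l δ = 0}) :
    ∃ C, ∀ x y z, IsTriple Φ l x y z → ψ x y z = C := by
  by_cases! hex : ∃ x₀ y₀ z₀, IsStandardTriple Φ l x₀ y₀ z₀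
  · obtain ⟨x₀, y₀, z₀, t₀⟩ := hex
    refine ⟨ψ x₀ y₀ z₀, fun x y z t => ?_⟩
    obtain ⟨x', y', z', t', e⟩ := t.exists_isStandardTriple h hlev hψ
    have hmem := hcl _ t₀.mem₃ _ t'.mem₃ (by rw [t₀.level₃, t'.level₃])
    rw [← AddSubgroup.mem_toAddSubmonoid, AddSubgroup.closure_toAddSubmonoid] at hmem
    obtain ⟨s, hs, hsum⟩ := AddSubmonoid.exists_multiset_of_mem_closure hmem
    rw [e]
    refine t₀.eq_of_multiset_sum h hlev hψ s (fun δ hδ => ?_) t' hsum.symm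
    rcases hs δ hδ with hd | hd
    · exact hd
    · exact ⟨by simpa using h.neg_mem _ hd.1, by simpa using hd.2⟩
  · refine ⟨Classical.arbitrary β, fun x y z t => ?_⟩
    obtain ⟨x', y', z', t', -⟩ := t.exists_isStandardTriple h hlev hψ
    exact absurd t' (hex x' y' z')

end Triples

/-- The coordinates of a vector at `j` and `k`, each replaced by zero if its index is in `Γ`. -/
def outerLevel {ι : Type*} (c : ι → V →+ ℝ) (Γ : Set ι) (j k : ι) : V →+ ℝ × ℝ :=
  (Γᶜ.indicator c j).prod (Γᶜ.indicator c k)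

/-- The additive functional on levels with values `a` and `b` at `(1, 0)` and `(0, 1)`. -/
def levelFunctional (a b : ℂ) : ℝ × ℝ →+ ℂ :=
  ((LinearMap.toSpanSingleton ℝ ℂ a).coprod (LinearMap.toSpanSingleton ℝ ℂ b)).toAddMonoidHom

section OuterLevel

variable {ι : Type*} {Φ : Set V} {α : ι → V} {c : ι → V →+ ℝ} {Γ : Set ι} {j k : ι}
  (hΓ : ∀ i ∉ Γ, i = j ∨ i = k)
include hΓ

theorem outerLevel_eq_zero_iff {x : V} : outerLevel c Γ j k x = 0 ↔ ∀ i ∉ Γ, c i x = 0 := by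
  have key : ∀ i, Γᶜ.indicator c i x = 0 ↔ (i ∉ Γ → c i x = 0) := fun i => by
    by_cases hi : i ∈ Γ <;> simp [hi]
  rw [outerLevel, AddMonoidHom.prod_apply, Prod.mk_eq_zero, key, key]
  refine ⟨fun h i hi => ?_, fun h => ⟨h j, h k⟩⟩
  rcases hΓ i hi with rfl | rfl
  exacts [h.1 hi, h.2 hi]

variable (hb : IsBased Φ α c)
include hb

theorem outerLevel_root_of_mem {i : ι} (hi : i ∈ Γ) : outerLevel c Γ j k (α i) = 0 :=
  (outerLevel_eq_zero_iff hΓ).mpr fun _ hi' => hb.coord_ne _ _ fun e => hi' (e ▸ hi)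

theorem sub_mem_closure_of_outerLevel_eq {x y : V} (hx : x ∈ Φ) (hy : y ∈ Φ)
    (hxy : outerLevel c Γ j k x = outerLevel c Γ j k y) :
    x - y ∈ AddSubgroup.closure {δ | δ ∈ Φ ∧ outerLevel c Γ j k δ = 0} := by
  refine AddSubgroup.closure_mono ?_ (hb.mem_closure_image (Γ := Γ)
    (sub_mem (hb.mem_closure_range hx) (hb.mem_closure_range hy))
    ((outerLevel_eq_zero_iff hΓ).mp (by rw [map_sub, hxy, sub_self])))
  rintro _ ⟨i, hi, rfl⟩
  exact ⟨hb.mem i, outerLevel_root_of_mem hΓ hb hi⟩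

variable (hjk : j ≠ k)
include hjk

omit hΓ in
theorem outerLevel_root_left (hj : j ∉ Γ) : outerLevel c Γ j k (α j) = (1, 0) := by
  by_cases hk : k ∈ Γ <;> simp [outerLevel, hj, hk, hb.coord_self, hb.coord_ne k j hjk.symm]

omit hΓ in
theorem outerLevel_root_right (hk : k ∉ Γ) : outerLevel c Γ j k (α k) = (0, 1) := by
  by_cases hj : j ∈ Γ <;> simp [outerLevel, hj, hk, hb.coord_self, hb.coord_ne j k hjk]

theorem levelFunctional_outerLevel {g : V →+ ℂ} (hg : ∀ i ∈ Γ, g (α i) = 0) {x : V} (hx : x ∈ Φ) :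
    levelFunctional (g (α j)) (g (α k)) (outerLevel c Γ j k x) = g x := by
  have key : Set.EqOn ((levelFunctional (g (α j)) (g (α k))).comp (outerLevel c Γ j k)) g
      (Set.range α) := by
    rintro _ ⟨i, rfl⟩
    rw [AddMonoidHom.comp_apply]
    by_cases hi : i ∈ Γ
    · rw [outerLevel_root_of_mem hΓ hb hi, map_zero, hg i hi]
    · rcases hΓ i hi with rfl | rfl
      · simp [outerLevel_root_left hb hjk hi, levelFunctional]
      · simp [outerLevel_root_right hb hjk hi, levelFunctional]
  exact AddMonoidHom.eqOn_closure key (hb.mem_closure_range hx)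

variable {lam g : V →+ ℂ} {K : ℂ} (hK : K ≠ 0) (hC : IsGoodPair Φ lam g K)
  (ha : IsAdapted Φ α c Γ lam g)
include hK hC ha

theorem isSmallLevel_outerLevel_or_neg {x : V} (hx : x ∈ Φ) :
    IsSmallLevel (1, 0) (0, 1) (outerLevel c Γ j k x) ∨
      IsSmallLevel (1, 0) (0, 1) (outerLevel c Γ j k (-x)) := by
  have hlam := fun x hx => levelFunctional_outerLevel hΓ hb hjk ha.lam_eq_zero (x := x) hx
  have hg := fun x hx => levelFunctional_outerLevel hΓ hb hjk ha.g_eq_zero (x := x) hx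
  refine isSmallLevel_or_neg (Lam := levelFunctional (lam (α j)) (lam (α k)))
    (G := levelFunctional (g (α j)) (g (α k))) hb hK (by simp) (by simp) (by simp) (fun i => ?_)
    (fun x hx hx0 => ?_) (fun x hx y hy hxy => ?_) hx
  · by_cases hi : i ∈ Γ
    · exact Or.inl (outerLevel_root_of_mem hΓ hb hi)
    · rcases hΓ i hi with rfl | rfl
      · exact Or.inr (Or.inl (outerLevel_root_left hb hjk hi))
      · exact Or.inr (Or.inr (outerLevel_root_right hb hjk hi))
  · rw [Ne, outerLevel_eq_zero_iff hΓ] at hx0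
    push Not at hx0
    obtain ⟨i, hi, hxi⟩ := hx0
    rw [hlam x hx]
    exact ha.lam_ne_zero x hx i hi hxi
  · have := hC x hx y hy hxy
    rw [IsCompatible, wronskian, ← map_add, hlam _ hxy]
    rwa [hlam x hx, hlam y hy, hg x hx, hg y hy]

theorem IsMoveInvariant.exists_const_of_isGoodPair {β : Type*} [Nonempty β] {B : V →+ V →+ ℝ}
    {ψ : V → V → V → β} (h : IsSimplyLaced Φ B) (hψ : IsMoveInvariant Φ (outerLevel c Γ j k) ψ) :
    ∃ C, ∀ x y z, IsTriple Φ (outerLevel c Γ j k) x y z → ψ x y z = C :=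
  hψ.exists_const h (fun _ hx => isSmallLevel_outerLevel_or_neg hΓ hb hjk hK hC ha hx)
    fun _ hx _ hy => sub_mem_closure_of_outerLevel_eq hΓ hb hx hy

end OuterLevel

end Combinatorics

/-! ### Contractions with the Killing form -/

section Contraction

variable {L : Type*} [LieRing L] [LieAlgebra ℂ L]

theorem polyvector_induction {n : ℕ} {p : ⋀[ℂ]^n L → Prop}
    (ιMulti : ∀ X, p (exteriorPower.ιMulti ℂ n X)) (add : ∀ v w, p v → p w → p (v + w))
    (smul : ∀ (c : ℂ) v, p v → p (c • v)) (v : ⋀[ℂ]^n L) : p v := by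
  have hv : v ∈ Submodule.span ℂ (Set.range (exteriorPower.ιMulti ℂ n (M := L))) := by
    rw [exteriorPower.ιMulti_span]; trivial
  induction hv using Submodule.span_induction with
  | mem x hx => obtain ⟨X, rfl⟩ := hx; exact ιMulti X
  | zero => simpa using smul 0 _ (ιMulti 0)
  | add x y _ _ hx hy => exact add _ _ hx hy
  | smul c x _ hx => exact smul _ _ hx

theorem bivector_induction {p : ⋀[ℂ]^2 L → Prop} (wedge : ∀ X Y, p (wedge₂ X Y))
    (add : ∀ v w, p v → p w → p (v + w)) (smul : ∀ (c : ℂ) v, p v → p (c • v)) (v : ⋀[ℂ]^2 L) :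
    p v :=
  polyvector_induction (fun X => FinVec.etaExpand_eq X ▸ wedge (X 0) (X 1)) add smul v

theorem trivector_induction {p : ⋀[ℂ]^3 L → Prop} (wedge : ∀ X Y Z, p (wedge₃ X Y Z))
    (add : ∀ v w, p v → p w → p (v + w)) (smul : ∀ (c : ℂ) v, p v → p (c • v)) (v : ⋀[ℂ]^3 L) :
    p v :=
  polyvector_induction (fun X => FinVec.etaExpand_eq X ▸ wedge (X 0) (X 1) (X 2)) add smul v

theorem adExt_wedge₂ (x X Y : L) :
    adExt 2 x (wedge₂ X Y) = wedge₂ ⁅x, X⁆ Y + wedge₂ X ⁅x, Y⁆ := by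
  rw [wedge₂, adExt_ιMulti, Fin.sum_univ_two, wedge₂, wedge₂]
  congr 2 <;> funext i <;> fin_cases i <;> rfl

theorem adExt_wedge₃ (x X Y Z : L) :
    adExt 3 x (wedge₃ X Y Z) = wedge₃ ⁅x, X⁆ Y Z + wedge₃ X ⁅x, Y⁆ Z + wedge₃ X Y ⁅x, Z⁆ := by
  rw [wedge₃, adExt_ιMulti, Fin.sum_univ_three, update_vec₃_zero, update_vec₃_one,
    update_vec₃_two]
  rfl

theorem map_wedge₃ (f : L →ₗ[ℂ] L) (X Y Z : L) :
    exteriorPower.map 3 f (wedge₃ X Y Z) = wedge₃ (f X) (f Y) (f Z) := by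
  rw [wedge₃, exteriorPower.map_apply_ιMulti, wedge₃]
  congr 1; funext i; fin_cases i <;> rfl

theorem killingForm_lie_left (x a y : L) :
    killingForm ℂ L ⁅x, a⁆ y = -killingForm ℂ L a ⁅x, y⁆ := by
  rw [← lie_skew, map_neg, LinearMap.neg_apply, LieModule.traceForm_apply_lie_apply]

/-- The contraction of a trivector with `a, b, c` under the Killing form:
`X ∧ Y ∧ Z` is sent to the determinant of the matrix of the values `(a, X), …, (c, Z)`. -/
def tri (a b c : L) : ⋀[ℂ]^3 L →ₗ[ℂ] ℂ :=
  exteriorPower.alternatingMapToDual ℂ L 3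
    ![killingForm ℂ L a, killingForm ℂ L b, killingForm ℂ L c]

theorem tri_wedge₃ (a b c X Y Z : L) :
    tri a b c (wedge₃ X Y Z) =
      killingForm ℂ L a X *
          (killingForm ℂ L b Y * killingForm ℂ L c Z - killingForm ℂ L b Z * killingForm ℂ L c Y) -
        killingForm ℂ L a Y *
          (killingForm ℂ L b X * killingForm ℂ L c Z - killingForm ℂ L b Z * killingForm ℂ L c X) +
        killingForm ℂ L a Z *
          (killingForm ℂ L b X * killingForm ℂ L c Y -
            killingForm ℂ L b Y * killingForm ℂ L c X) := by
  rw [tri, wedge₃, exteriorPower.alternatingMapToDual_apply_ιMulti, Matrix.det_fin_three]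
  simp only [Matrix.of_apply, Matrix.cons_val]
  ring

theorem tri_add_left (a a' b c : L) (w : ⋀[ℂ]^3 L) :
    tri (a + a') b c w = tri a b c w + tri a' b c w := by
  induction w using trivector_induction with
  | wedge X Y Z => simp only [tri_wedge₃, map_add, LinearMap.add_apply]; ring
  | add v w hv hw => rw [map_add, map_add, map_add, hv, hw]; ring
  | smul r v hv => rw [map_smul, map_smul, map_smul, hv, smul_add]

theorem tri_smul_left (r : ℂ) (a b c : L) (w : ⋀[ℂ]^3 L) :
    tri (r • a) b c w = r * tri a b c w := by
  induction w using trivector_induction with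
  | wedge X Y Z =>
    simp only [tri_wedge₃, map_smul, LinearMap.smul_apply, smul_eq_mul]; ring
  | add v w hv hw => rw [map_add, map_add, hv, hw]; ring
  | smul s v hv => rw [map_smul, map_smul, hv, smul_eq_mul, smul_eq_mul]; ring

theorem tri_rotate (a b c : L) (w : ⋀[ℂ]^3 L) : tri b c a w = tri a b c w := by
  induction w using trivector_induction with
  | wedge X Y Z => simp only [tri_wedge₃]; ring
  | add v w hv hw => rw [map_add, map_add, hv, hw]
  | smul s v hv => rw [map_smul, map_smul, hv]

theorem tri_swap (a b c : L) (w : ⋀[ℂ]^3 L) : tri b a c w = -tri a b c w := by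
  induction w using trivector_induction with
  | wedge X Y Z => simp only [tri_wedge₃]; ring
  | add v w hv hw => rw [map_add, map_add, hv, hw]; ring
  | smul s v hv => rw [map_smul, map_smul, hv, smul_neg]

theorem tri_smul_mid (r : ℂ) (a b c : L) (w : ⋀[ℂ]^3 L) :
    tri a (r • b) c w = r * tri a b c w := by
  rw [← tri_rotate, tri_smul_left, tri_rotate]

theorem tri_smul_right (r : ℂ) (a b c : L) (w : ⋀[ℂ]^3 L) :
    tri a b (r • c) w = r * tri a b c w := by
  rw [← tri_rotate, ← tri_rotate, tri_smul_left, tri_rotate, tri_rotate]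

theorem tri_adExt (x a b c : L) (w : ⋀[ℂ]^3 L) :
    tri a b c (adExt 3 x w) = -(tri ⁅x, a⁆ b c w + tri a ⁅x, b⁆ c w + tri a b ⁅x, c⁆ w) := by
  induction w using trivector_induction with
  | wedge X Y Z =>
    simp only [adExt_wedge₃, map_add, tri_wedge₃, killingForm_lie_left]; ring
  | add v w hv hw => simp only [map_add, hv, hw]; ring
  | smul s v hv => simp only [map_smul, hv, smul_eq_mul]; ring

theorem tri_map (f : L →ₗ[ℂ] L) {a b c a' b' c' : L}
    (ha : ∀ x, killingForm ℂ L a (f x) = killingForm ℂ L a' x)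
    (hb : ∀ x, killingForm ℂ L b (f x) = killingForm ℂ L b' x)
    (hc : ∀ x, killingForm ℂ L c (f x) = killingForm ℂ L c' x) (w : ⋀[ℂ]^3 L) :
    tri a b c (exteriorPower.map 3 f w) = tri a' b' c' w := by
  induction w using trivector_induction with
  | wedge X Y Z => simp only [map_wedge₃, tri_wedge₃, ha, hb, hc]
  | add v w hv hw => simp only [map_add, hv, hw]
  | smul s v hv => simp only [map_smul, hv]

/-- `sharp` on decomposable bivectors, as an alternating map of the two factors. -/
def sharpAlt : L [⋀^Fin 2]→ₗ[ℂ] (L →ₗ[ℂ] L) where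
  toFun v := ((killingForm ℂ L).flip (v 1)).smulRight (v 0) -
    ((killingForm ℂ L).flip (v 0)).smulRight (v 1)
  map_update_add' := by
    intro dec v i x y
    rw [Subsingleton.elim dec (instDecidableEqFin 2)]
    ext a
    fin_cases i <;> simp [add_smul] <;> abel
  map_update_smul' := by
    intro dec v i c x
    rw [Subsingleton.elim dec (instDecidableEqFin 2)]
    ext a
    fin_cases i <;> simp [smul_sub, mul_smul, smul_comm _ c]
  map_eq_zero_of_eq' := by
    intro v i j h hij
    have h01 : v 0 = v 1 := by
      fin_cases i <;> fin_cases j <;> simp_all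
    rw [h01, sub_self]

/-- The endomorphism `f♯` attached to a bivector by the Killing form:
`(X ∧ Y)♯ a = (a, Y) X - (a, X) Y`. -/
def sharp : ⋀[ℂ]^2 L →ₗ[ℂ] (L →ₗ[ℂ] L) := exteriorPower.alternatingMapLinearEquiv sharpAlt

theorem sharp_wedge₂ (X Y a : L) :
    sharp (wedge₂ X Y) a = killingForm ℂ L a Y • X - killingForm ℂ L a X • Y := by
  rw [sharp, wedge₂, exteriorPower.alternatingMapLinearEquiv_apply_ιMulti]
  rfl

theorem killingForm_sharp (f : ⋀[ℂ]^2 L) (a b : L) :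
    killingForm ℂ L (sharp f a) b = -killingForm ℂ L a (sharp f b) := by
  induction f using bivector_induction with
  | wedge X Y =>
    simp only [sharp_wedge₂, map_sub, map_smul, LinearMap.sub_apply, LinearMap.smul_apply,
      smul_eq_mul, LieModule.traceForm_comm ℂ L L b]
    ring
  | add v w hv hw => simp only [map_add, LinearMap.add_apply, hv, hw]; ring
  | smul s v hv => simp only [map_smul, LinearMap.smul_apply, hv, smul_neg]

theorem sharp_adExt (x : L) (f : ⋀[ℂ]^2 L) (a : L) :
    sharp (adExt 2 x f) a = ⁅x, sharp f a⁆ - sharp f ⁅x, a⁆ := by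
  induction f using bivector_induction with
  | wedge X Y =>
    simp only [adExt_wedge₂, map_add, LinearMap.add_apply, sharp_wedge₂, lie_sub, lie_smul,
      killingForm_lie_left, neg_smul]
    abel
  | add v w hv hw => simp only [map_add, LinearMap.add_apply, hv, hw, lie_add]; abel
  | smul s v hv => simp only [map_smul, LinearMap.smul_apply, hv, lie_smul, smul_sub]

theorem tri_schouten (f g : ⋀[ℂ]^2 L) (a b c : L) :
    tri a b c (schouten f g) =
      killingForm ℂ L c (⁅sharp f a, sharp g b⁆ + ⁅sharp g a, sharp f b⁆) +
      killingForm ℂ L a (⁅sharp f b, sharp g c⁆ + ⁅sharp g b, sharp f c⁆) +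
      killingForm ℂ L b (⁅sharp f c, sharp g a⁆ + ⁅sharp g c, sharp f a⁆) := by
  induction f using bivector_induction with
  | wedge X₁ X₂ =>
    induction g using bivector_induction with
    | wedge Y₁ Y₂ =>
      simp only [schouten_wedge₂, sharp_wedge₂, map_sub, map_add, tri_wedge₃, lie_sub, sub_lie,
        smul_lie, lie_smul, map_smul, smul_eq_mul, ← lie_skew X₁ Y₁, ← lie_skew X₁ Y₂,
        ← lie_skew X₂ Y₁, ← lie_skew X₂ Y₂, map_neg]
      ring
    | add v w hv hw =>
      simp only [map_add, LinearMap.add_apply, hv, hw, lie_add, add_lie]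
      ring
    | smul s v hv =>
      simp only [map_smul, LinearMap.smul_apply, hv, lie_smul, smul_lie, map_add, smul_eq_mul]
      ring
  | add v w hv hw =>
    simp only [map_add, LinearMap.add_apply, hv, hw, lie_add, add_lie]
    ring
  | smul s v hv =>
    simp only [map_smul, LinearMap.smul_apply, hv, lie_smul, smul_lie, map_add, smul_eq_mul]
    ring

end Contraction

/-! ### The root system attached to a base -/

section RootSystem

variable {ι V W : Type*} [AddCommGroup V] [Module ℂ V] [AddCommGroup W] [Module ℂ W]
  {P : RootPairing ι ℂ V W}

/-- The Dynkin diagram of the base `b` is simply laced and star-shaped with three legs. -/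
def HasStarDiagram [P.IsCrystallographic] (b : P.Base) : Prop :=
  ∃ o p node, IsStarShaped b.cartanMatrix o p node

theorem toLinearMap_root_coroot [P.IsCrystallographic] (i j : ι) :
    P.toLinearMap (P.root i) (P.coroot j) = (P.pairingIn ℤ i j : ℂ) :=
  (P.root_coroot_eq_pairing i j).trans (P.algebraMap_pairingIn ℤ i j).symm

variable [P.IsRootSystem]

/-- The linear map that sends each simple root to its coroot. -/
def corootMap (b : P.Base) : V →ₗ[ℂ] W :=
  b.toWeightBasis.constr ℂ fun i => P.coroot i

theorem corootMap_simple (b : P.Base) (i : b.support) :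
    corootMap b (P.root i) = P.coroot i := by
  rw [← b.toWeightBasis_apply, corootMap, Module.Basis.constr_basis]

/-- The invariant form on the root space for which all roots have square length two (its real part,
which contains all the information on the lattice of roots). -/
def rootForm (b : P.Base) : V →+ V →+ ℝ :=
  AddMonoidHom.mk' (fun x => AddMonoidHom.mk' (fun y => (P.toLinearMap x (corootMap b y)).re)
    (by intros; simp)) (by intros; ext; simp)

/-- The (real parts of the) coordinates with respect to the base. -/
def baseCoord (b : P.Base) (i : b.support) : V →+ ℝ :=
  AddMonoidHom.mk' (fun x => (b.toWeightBasis.repr x i).re) (by intros; simp)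

theorem baseCoord_apply (b : P.Base) (i : b.support) (x : V) :
    baseCoord b i x = (b.toWeightBasis.repr x i).re := rfl

variable [P.IsCrystallographic]

theorem toLinearMap_corootMap_symm {b : P.Base} (hs : b.cartanMatrix.IsSymm) (x y : V) :
    P.toLinearMap x (corootMap b y) = P.toLinearMap y (corootMap b x) := by
  let F : V →ₗ[ℂ] V →ₗ[ℂ] ℂ := P.toLinearMap.compl₂ (corootMap b)
  suffices h : F = F.flip from LinearMap.congr_fun₂ h x y
  refine b.toWeightBasis.ext fun i => b.toWeightBasis.ext fun j => ?_
  simp only [F, LinearMap.compl₂_apply, LinearMap.flip_apply, b.toWeightBasis_apply,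
    corootMap_simple, toLinearMap_root_coroot]
  exact_mod_cast hs.apply j i

variable [Finite ι]

theorem isBased_range_root (b : P.Base) :
    IsBased (Set.range P.root) (fun i : b.support => P.root i) (baseCoord b) where
  mem i := Set.mem_range_self _
  coord_self i := by
    rw [baseCoord_apply, b.toWeightBasis_repr_root]
    simp
  coord_ne i j h := by
    rw [baseCoord_apply, b.toWeightBasis_repr_root, Finsupp.single_eq_of_ne h]
    simp
  induction p h₁ h₂ := by
    have hpos : ∀ i, b.IsPos i → p (P.root i) := by
      intro i hi
      refine hi.induction_on_add (p := fun i => p (P.root i))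
        (fun i hi => h₁ ⟨i, hi⟩) fun i j k hk hi hj => ?_
      rw [hk]
      exact h₂ _ ⟨i, rfl⟩ ⟨j, hj⟩ hi ⟨k, hk⟩
    rintro _ ⟨i, rfl⟩
    let := P.indexNeg
    rcases RootPairing.Base.IsPos.or_neg b i with h | h
    · exact .inl (hpos i h)
    · have hneg := hpos _ h
      rw [RootPairing.indexNeg_neg, RootPairing.root_reflectionPerm,
        RootPairing.reflection_apply_self] at hneg
      exact .inr hneg

variable [P.IsReduced]

theorem corootMap_root {b : P.Base} (hs : b.cartanMatrix.IsSymm) (i : ι) :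
    corootMap b (P.root i) = P.coroot i := by
  induction i using b.induction_reflect with
  | h₀ i hi =>
    rw [RootPairing.root_reflectionPerm, RootPairing.coroot_reflectionPerm,
      RootPairing.reflection_apply_self, RootPairing.coreflection_apply_self, map_neg, hi]
  | h₁ i hi => exact corootMap_simple b ⟨i, hi⟩
  | h₂ i j hi hj =>
    have hj' := corootMap_simple b ⟨j, hj⟩
    have hp : P.pairing i j = P.pairing j i := by
      have h := toLinearMap_corootMap_symm hs (P.root i) (P.root j)
      rwa [hi, hj'] at h
    rw [RootPairing.root_reflectionPerm, RootPairing.coroot_reflectionPerm,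
      RootPairing.reflection_apply_root, RootPairing.coreflection_apply_coroot, map_sub, map_smul,
      hi, hj', hp]

theorem rootForm_root {b : P.Base} (hs : b.cartanMatrix.IsSymm) (i j : ι) :
    rootForm b (P.root i) (P.root j) = (P.pairingIn ℤ i j : ℝ) := by
  change (P.toLinearMap (P.root i) (corootMap b (P.root j))).re = _
  rw [corootMap_root hs, toLinearMap_root_coroot, Complex.intCast_re]

theorem isSimplyLaced_range_root {b : P.Base} (hs : b.cartanMatrix.IsSymm) :
    IsSimplyLaced (Set.range P.root) (rootForm b) where
  symm x y := congrArg Complex.re (toLinearMap_corootMap_symm hs x y)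
  self := by
    rintro _ ⟨i, rfl⟩
    simp [rootForm_root hs]
  neg_mem _ := P.neg_mem_range_root_iff.2
  cases := by
    rintro _ ⟨i, rfl⟩ _ ⟨j, rfl⟩
    by_cases h₁ : P.root i = P.root j
    · exact .inl h₁
    by_cases h₂ : P.root i = -P.root j
    · exact .inr (.inl h₂)
    have hsymm : P.pairingIn ℤ j i = P.pairingIn ℤ i j := by
      have h := toLinearMap_corootMap_symm hs (P.root j) (P.root i)
      rw [corootMap_root hs, corootMap_root hs, toLinearMap_root_coroot,
        toLinearMap_root_coroot] at h
      exact_mod_cast h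
    have hmem := P.pairingIn_pairingIn_mem_set_of_isCrystal_of_isRed' i j h₁ h₂
    simp only [hsymm, Set.mem_insert_iff, Set.mem_singleton_iff, Prod.mk.injEq] at hmem
    have : P.pairingIn ℤ i j = -1 ∨ P.pairingIn ℤ i j = 0 ∨ P.pairingIn ℤ i j = 1 := by omega
    rw [rootForm_root hs]
    exact Or.inr (Or.inr (by exact_mod_cast this))
  add_mem := by
    rintro _ ⟨i, rfl⟩ _ ⟨j, rfl⟩ h
    rw [rootForm_root hs] at h
    have hij : P.pairingIn ℤ i j = -1 := by exact_mod_cast h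
    refine P.root_add_root_mem_of_pairingIn_neg (by rw [hij]; norm_num) fun e => ?_
    have hj := rootForm_root hs i j
    rw [e, map_neg, AddMonoidHom.neg_apply, rootForm_root hs, hij] at hj
    norm_num at hj

end RootSystem

open LieAlgebra LieAlgebra.IsKilling LieModule

/-! ### Root vectors indexed by the dual of the Cartan subalgebra -/

section RootSet

variable {L : Type*} [LieRing L] [LieAlgebra ℂ L] [FiniteDimensional ℂ L] [IsKilling ℂ L]
  {H : LieSubalgebra ℂ L} [H.IsCartanSubalgebra]

/-- The root system `Ω` as a subset of the dual of the Cartan subalgebra. -/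
abbrev rootSet (H : LieSubalgebra ℂ L) [H.IsCartanSubalgebra] : Set (Module.Dual ℂ H) :=
  Set.range (rootSystem H).root

/-- The negative of a root, as an element of the index type of the root system. -/
def negRoot (i : H.root) : H.root :=
  ⟨-i.1, Finset.mem_filter.2 ⟨Finset.mem_univ _, (H.isNonZero_coe_root i).neg⟩⟩

theorem root_negRoot (i : H.root) :
    (rootSystem H).root (negRoot i) = -(rootSystem H).root i := by
  simp [negRoot]

theorem root_mem_rootSet (i : H.root) : (rootSystem H).root i ∈ rootSet H :=
  Set.mem_range_self i

theorem neg_mem_rootSet {x : Module.Dual ℂ H} (hx : x ∈ rootSet H) : -x ∈ rootSet H := by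
  obtain ⟨i, rfl⟩ := hx
  exact ⟨negRoot i, root_negRoot i⟩

theorem mem_rootSet_of_rootSpace_ne_bot {x : Module.Dual ℂ H} (hx : x ≠ 0)
    (h : rootSpace H x ≠ ⊥) : x ∈ rootSet H := by
  refine ⟨⟨⟨x, h⟩, Finset.mem_filter.2 ⟨Finset.mem_univ _, fun h0 => hx ?_⟩⟩, ?_⟩
  · ext t; exact congrFun h0 t
  · ext t; rfl

theorem apply_cartanEquivDual_symm_ne_zero {i j : H.root}
    (h : (rootSystem H).pairingIn ℤ j i ≠ 0) : j.1 ((cartanEquivDual H).symm i.1) ≠ 0 := by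
  refine fun h0 => h ?_
  have hroot : (rootSystem H).root j ((cartanEquivDual H).symm i.1) = 0 := h0
  have hcoroot : (rootSystem H).root j ((rootSystem H).coroot i) = 0 := by
    rw [rootSystem_coroot_apply, coroot, map_nsmul, map_smul, hroot, smul_zero, smul_zero]
  have hpairing := toLinearMap_root_coroot (P := rootSystem H) j i
  exact Int.cast_eq_zero.1 (hpairing.symm.trans hcoroot)

end RootSet

variable {L : Type*} [LieRing L] [LieAlgebra ℂ L] [FiniteDimensional ℂ L]
  [LieAlgebra.IsSimple ℂ L] {H : LieSubalgebra ℂ L} [H.IsCartanSubalgebra]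

open Classical in
/-- The root vector attached to a root, viewed as an element of the dual of the Cartan
subalgebra; zero at the elements that are not roots. -/
def RootVectors.vec (R : RootVectors H) (x : Module.Dual ℂ H) : L :=
  if h : ∃ i : H.root, (rootSystem H).root i = x then R.E h.choose.1 else 0

namespace RootVectors

variable (R : RootVectors H) {x y : Module.Dual ℂ H}

theorem vec_root (i : H.root) : R.vec ((rootSystem H).root i) = R.E i.1 := by
  have h : ∃ j : H.root, (rootSystem H).root j = (rootSystem H).root i := ⟨i, rfl⟩
  rw [vec, dif_pos h, (rootSystem H).root.injective h.choose_spec]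

theorem vec_neg_root (i : H.root) : R.vec (-(rootSystem H).root i) = R.E (-i.1) := by
  rw [← root_negRoot, vec_root]
  rfl

theorem vec_mem (hx : x ∈ rootSet H) : R.vec x ∈ rootSpace H x := by
  obtain ⟨i, rfl⟩ := hx
  rw [vec_root]
  exact R.mem_rootSpace _ (H.isNonZero_coe_root i)

theorem vec_root_mem (i : H.root) : R.vec ((rootSystem H).root i) ∈ rootSpace H i.1 := by
  rw [vec_root]
  exact R.mem_rootSpace _ (H.isNonZero_coe_root i)

theorem vec_neg_root_mem (i : H.root) :
    R.vec (-(rootSystem H).root i) ∈ rootSpace H (-i.1) := by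
  rw [vec_neg_root, ← Weight.coe_neg]
  exact R.mem_rootSpace _ (H.isNonZero_coe_root i).neg

theorem lie_vec (hx : x ∈ rootSet H) {h : L} (hh : h ∈ H) : ⁅h, R.vec x⁆ = x ⟨h, hh⟩ • R.vec x :=
  lie_eq_smul_of_mem_rootSpace (R.vec_mem hx) ⟨h, hh⟩

theorem killingForm_vec_neg (hx : x ∈ rootSet H) :
    killingForm ℂ L (R.vec x) (R.vec (-x)) = 1 := by
  obtain ⟨i, rfl⟩ := hx
  rw [vec_root, vec_neg_root]
  exact R.killing_eq_one _ (H.isNonZero_coe_root i)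

theorem vec_ne_zero (hx : x ∈ rootSet H) : R.vec x ≠ 0 := fun h =>
  zero_ne_one (α := ℂ) <| by
    rw [← R.killingForm_vec_neg hx, h, map_zero, LinearMap.zero_apply]

theorem killingForm_eq_zero {a : L} (ha : a ∈ rootSpace H x) (hy : y ∈ rootSet H)
    (hxy : x + y ≠ 0) : killingForm ℂ L a (R.vec y) = 0 := by
  refine killingForm_apply_eq_zero_of_mem_rootSpace_of_add_ne_zero ℂ L H ha (R.vec_mem hy)
    fun h => hxy ?_
  ext t; exact congrFun h t

theorem killingForm_vec_vec (hx : x ∈ rootSet H) (hy : y ∈ rootSet H) (hxy : x + y ≠ 0) :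
    killingForm ℂ L (R.vec x) (R.vec y) = 0 :=
  R.killingForm_eq_zero (R.vec_mem hx) hy hxy

theorem eq_smul_vec (hx : x ∈ rootSet H) {a : L} (ha : a ∈ rootSpace H x) :
    a = killingForm ℂ L a (R.vec (-x)) • R.vec x := by
  have hrank : Module.finrank ℂ (rootSpace H x) = 1 := by
    obtain ⟨i, rfl⟩ := hx
    exact finrank_rootSpace_eq_one _ (H.isNonZero_coe_root i)
  obtain ⟨c, hc⟩ := (finrank_eq_one_iff_of_nonzero' (⟨R.vec x, R.vec_mem hx⟩ : rootSpace H x)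
    (fun h => R.vec_ne_zero hx (congrArg Subtype.val h))).1 hrank ⟨a, ha⟩
  obtain rfl : c • R.vec x = a := congrArg Subtype.val hc
  rw [map_smul, LinearMap.smul_apply, R.killingForm_vec_neg hx, smul_eq_mul, mul_one]

theorem lie_vec_mem (hx : x ∈ rootSet H) (hy : y ∈ rootSet H) :
    ⁅R.vec x, R.vec y⁆ ∈ rootSpace H (x + y : Module.Dual ℂ H) :=
  lie_mem_genWeightSpace_of_mem_genWeightSpace (R.vec_mem hx) (R.vec_mem hy)

theorem lie_vec_eq_zero (hx : x ∈ rootSet H) (hy : y ∈ rootSet H) (h0 : x + y ≠ 0)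
    (hxy : x + y ∉ rootSet H) : ⁅R.vec x, R.vec y⁆ = 0 := by
  by_contra hne
  refine hxy (mem_rootSet_of_rootSpace_ne_bot h0 fun h => hne ?_)
  have hmem := R.lie_vec_mem hx hy
  rwa [h] at hmem

theorem lie_vec_neg (i : H.root) :
    ⁅R.vec ((rootSystem H).root i), R.vec (-(rootSystem H).root i)⁆ =
      ((cartanEquivDual H).symm i.1 : L) := by
  have hkilling := R.killingForm_vec_neg (root_mem_rootSet i)
  have hpos := R.mem_rootSpace _ (H.isNonZero_coe_root i)
  have hneg := R.mem_rootSpace _ (H.isNonZero_coe_root i).neg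
  rw [vec_root, vec_neg_root] at hkilling ⊢
  rw [Weight.coe_neg] at hneg
  rw [lie_eq_killingForm_smul_of_mem_rootSpace_of_mem_rootSpace_neg hpos hneg, hkilling, one_smul]

theorem lie_vec_eq_smul (hx : x ∈ rootSet H) (hy : y ∈ rootSet H) (hxy : x + y ∈ rootSet H) :
    ⁅R.vec x, R.vec y⁆ = killingForm ℂ L ⁅R.vec x, R.vec y⁆ (R.vec (-(x + y))) • R.vec (x + y) :=
  R.eq_smul_vec hxy (R.lie_vec_mem hx hy)

/-- If the bracket vanished, then so would `⁅E_x, ⁅E_{-x}, E_y⁆⁆ - ⁅E_{-x}, ⁅E_x, E_y⁆⁆`, as `y - x`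
is not a root; but this is `⁅⁅E_x, E_{-x}⁆, E_y⁆`, which is the multiple `(x, y) ≠ 0` of `E_y`. -/
theorem lie_vec_ne_zero {b : (rootSystem H).Base} (hs : b.cartanMatrix.IsSymm)
    (hx : x ∈ rootSet H) (hy : y ∈ rootSet H) (hxy : x + y ∈ rootSet H) :
    ⁅R.vec x, R.vec y⁆ ≠ 0 := by
  intro h0
  have hB := isSimplyLaced_range_root hs
  have hB₁ : rootForm b y x = -1 := by rw [hB.symm, hB.eq_neg_one_of_add_mem hx hy hxy]
  have hne : -x + y ≠ 0 := fun h => by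
    rw [neg_add_eq_zero.1 h, hB.self _ hy] at hB₁
    norm_num at hB₁
  have hmem : -x + y ∉ rootSet H := fun h => by
    rw [neg_add_eq_sub] at h
    rw [hB.eq_one_of_sub_mem hy hx h] at hB₁
    norm_num at hB₁
  obtain ⟨i, rfl⟩ := hx
  obtain ⟨j, rfl⟩ := hy
  have hjacobi := lie_lie (R.vec ((rootSystem H).root i)) (R.vec (-(rootSystem H).root i))
    (R.vec ((rootSystem H).root j))
  rw [R.lie_vec_eq_zero (neg_mem_rootSet (root_mem_rootSet i)) (root_mem_rootSet j) hne hmem, h0,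
    lie_zero, lie_zero, sub_zero, R.lie_vec_neg, R.lie_vec (root_mem_rootSet j)
    (SetLike.coe_mem _)] at hjacobi
  refine (smul_ne_zero (apply_cartanEquivDual_symm_ne_zero fun h => ?_)
    (R.vec_ne_zero (root_mem_rootSet j))) hjacobi
  rw [rootForm_root hs, h] at hB₁
  norm_num at hB₁

end RootVectors

/-! ### Levi subalgebras and the tangent space -/

section Levi

/-- The span of `Γ` in the dual of the Cartan subalgebra. -/
def leviSpan (Γ : Finset H.root) : Submodule ℂ (Module.Dual ℂ H) :=
  Submodule.span ℂ ((rootSystem H).root '' (Γ : Set H.root))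

/-- The roots outside the span of `Γ`. -/
def outerRoots (Γ : Finset H.root) : Set (Module.Dual ℂ H) := {x ∈ rootSet H | x ∉ leviSpan Γ}

variable {Γ : Finset H.root} {x y z : Module.Dual ℂ H}

omit [IsSimple ℂ L] in
theorem cartan_le_levi : H ≤ levi Γ := fun _ h => LieSubalgebra.subset_lieSpan (.inl h)

theorem neg_mem_outerRoots (hx : x ∈ outerRoots Γ) : -x ∈ outerRoots Γ :=
  ⟨neg_mem_rootSet hx.1, fun h => hx.2 ((leviSpan Γ).neg_mem_iff.1 h)⟩

theorem add_mem_outerRoots (hx : x ∈ leviSpan Γ) (hy : y ∈ outerRoots Γ)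
    (hxy : x + y ∈ rootSet H) : x + y ∈ outerRoots Γ :=
  ⟨hxy, fun h => hy.2 (((leviSpan Γ).add_mem_iff_right hx).1 h)⟩

theorem mem_leviSpan_iff {b : (rootSystem H).Base} (hΓ : Γ ⊆ b.support) (hx : x ∈ rootSet H) :
    x ∈ leviSpan Γ ↔ ∀ i : b.support, (i : H.root) ∉ Γ → baseCoord b i x = 0 := by
  have hb := isBased_range_root b
  constructor
  · intro h i hi
    have hle : leviSpan Γ ≤ LinearMap.ker (b.toWeightBasis.coord i) := by
      rw [leviSpan, Submodule.span_le]
      rintro _ ⟨j, hj, rfl⟩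
      have hne : i ≠ ⟨j, hΓ hj⟩ := fun h => hi (h ▸ hj)
      rw [SetLike.mem_coe, LinearMap.mem_ker, Module.Basis.coord_apply,
        b.toWeightBasis_repr_root ⟨j, hΓ hj⟩, Finsupp.single_eq_of_ne hne]
    rw [baseCoord_apply, show b.toWeightBasis.repr x i = 0 from hle h, Complex.zero_re]
  · intro h
    have hmem := hb.mem_closure_image (Γ := {i : b.support | (i : H.root) ∈ Γ})
      (hb.mem_closure_range hx) h
    refine (AddSubgroup.closure_le (leviSpan Γ).toAddSubgroup).2 ?_ hmem
    rintro _ ⟨i, hi, rfl⟩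
    exact Submodule.subset_span ⟨i, hi, rfl⟩

variable (R : RootVectors H)

theorem vec_add_mem_levi {b : (rootSystem H).Base} (hs : b.cartanMatrix.IsSymm)
    (hx : x ∈ rootSet H) (hy : y ∈ rootSet H) (hxy : x + y ∈ rootSet H)
    (hxΓ : R.vec x ∈ levi Γ) (hyΓ : R.vec y ∈ levi Γ) : R.vec (x + y) ∈ levi Γ := by
  have hmem := (levi Γ).lie_mem hxΓ hyΓ
  have hne := R.lie_vec_ne_zero hs hx hy hxy
  rw [R.lie_vec_eq_smul hx hy hxy] at hmem hne
  exact ((levi Γ).toSubmodule.smul_mem_iff (smul_ne_zero_iff.1 hne).1).1 hmem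

theorem vec_mem_levi {b : (rootSystem H).Base} (hs : b.cartanMatrix.IsSymm) (hΓ : Γ ⊆ b.support)
    (hx : x ∈ rootSet H) (hxΓ : x ∈ leviSpan Γ) : R.vec x ∈ levi Γ := by
  have hb := isBased_range_root b
  have simple_mem : ∀ i ∈ Γ, R.vec ((rootSystem H).root i) ∈ levi Γ ∧
      R.vec (-(rootSystem H).root i) ∈ levi Γ := fun i hi =>
    ⟨LieSubalgebra.subset_lieSpan (.inr ⟨i, hi, .inl (R.vec_root_mem i)⟩),
      LieSubalgebra.subset_lieSpan (.inr ⟨i, hi, .inr (R.vec_neg_root_mem i)⟩)⟩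
  refine (hb.induction_of_coord_eq_zero (p := fun x => R.vec x ∈ levi Γ ∧ R.vec (-x) ∈ levi Γ)
    (Γ := {i : b.support | (i : H.root) ∈ Γ}) (fun i hi => simple_mem i hi)
    (fun x hp => by rwa [neg_neg, and_comm] at hp) (fun x hx i hi hp hxi => ?_) hx
    ((mem_leviSpan_iff hΓ hx).1 hxΓ)).1
  refine ⟨vec_add_mem_levi R hs hx (hb.mem i) hxi hp.1 (simple_mem i hi).1, ?_⟩
  have hneg := neg_mem_rootSet hxi
  rw [neg_add] at hneg ⊢
  exact vec_add_mem_levi R hs (neg_mem_rootSet hx) (neg_mem_rootSet (hb.mem i)) hneg hp.2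
    (simple_mem i hi).2

theorem tangent_eq_span : tangent Γ = Submodule.span ℂ (R.vec '' outerRoots Γ) := by
  apply le_antisymm
  · refine iSup_le fun i => iSup_le fun hi a ha => ?_
    rw [R.eq_smul_vec (root_mem_rootSet i) ha]
    exact Submodule.smul_mem _ _ (Submodule.subset_span ⟨_, ⟨root_mem_rootSet i, hi⟩, rfl⟩)
  · rw [Submodule.span_le]
    rintro _ ⟨x, ⟨⟨i, rfl⟩, hx⟩, rfl⟩
    exact Submodule.mem_iSup_of_mem i (Submodule.mem_iSup_of_mem hx (R.vec_root_mem i))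

theorem vec_mem_tangent (hx : x ∈ outerRoots Γ) : R.vec x ∈ tangent Γ := by
  rw [tangent_eq_span R]
  exact Submodule.subset_span ⟨x, hx, rfl⟩

theorem lie_mem_tangent_of_vec {a m : L} (ha : ∀ x ∈ outerRoots Γ, ⁅a, R.vec x⁆ ∈ tangent Γ)
    (hm : m ∈ tangent Γ) : ⁅a, m⁆ ∈ tangent Γ := by
  have hle : tangent Γ ≤ (tangent Γ).comap (toEnd ℂ L L a) := by
    rw [tangent_eq_span R, Submodule.span_le, ← tangent_eq_span R]
    rintro _ ⟨x, hx, rfl⟩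
    exact ha x hx
  exact hle hm

include R

theorem lie_mem_tangent_of_mem_cartan {a m : L} (ha : a ∈ H) (hm : m ∈ tangent Γ) :
    ⁅a, m⁆ ∈ tangent Γ := by
  refine lie_mem_tangent_of_vec R (fun x hx => ?_) hm
  rw [R.lie_vec hx.1 ha]
  exact Submodule.smul_mem _ _ (vec_mem_tangent R hx)

theorem lie_mem_tangent_of_mem_rootSpace (hx : x ∈ rootSet H) (hxΓ : x ∈ leviSpan Γ) {a m : L}
    (ha : a ∈ rootSpace H x) (hm : m ∈ tangent Γ) : ⁅a, m⁆ ∈ tangent Γ := by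
  refine lie_mem_tangent_of_vec R (fun y hy => ?_) hm
  rw [R.eq_smul_vec hx ha, smul_lie]
  refine Submodule.smul_mem _ _ ?_
  by_cases hxy : x + y ∈ rootSet H
  · rw [R.lie_vec_eq_smul hx hy.1 hxy]
    exact Submodule.smul_mem _ _ (vec_mem_tangent R (add_mem_outerRoots hxΓ hy hxy))
  · have h0 : x + y ≠ 0 := fun h => hy.2 <| by
      rw [eq_neg_of_add_eq_zero_right h]
      exact (leviSpan Γ).neg_mem hxΓ
    rw [R.lie_vec_eq_zero hx hy.1 h0 hxy]
    exact zero_mem _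

theorem lie_mem_tangent {a m : L} (ha : a ∈ levi Γ) (hm : m ∈ tangent Γ) : ⁅a, m⁆ ∈ tangent Γ := by
  induction ha using LieSubalgebra.lieSpan_induction generalizing m with
  | mem a ha =>
    rcases ha with ha | ⟨i, hi, ha | ha⟩
    · exact lie_mem_tangent_of_mem_cartan R ha hm
    · exact lie_mem_tangent_of_mem_rootSpace R (root_mem_rootSet i)
        (Submodule.subset_span ⟨i, hi, rfl⟩) ha hm
    · exact lie_mem_tangent_of_mem_rootSpace R (neg_mem_rootSet (root_mem_rootSet i))
        ((leviSpan Γ).neg_mem (Submodule.subset_span ⟨i, hi, rfl⟩)) ha hm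
  | zero => rw [zero_lie]; exact zero_mem _
  | add _ _ _ _ h₁ h₂ => rw [add_lie]; exact add_mem (h₁ hm) (h₂ hm)
  | smul c _ _ h => rw [smul_lie]; exact Submodule.smul_mem _ _ (h hm)
  | lie a a' _ _ h₁ h₂ => rw [lie_lie]; exact sub_mem (h₁ (h₂ hm)) (h₂ (h₁ hm))

omit R
variable (R : RootVectors H)

theorem proj_apply (a : L) : open Classical in proj R Γ a =
    ∑ i : H.root with i ∉ leviRoots Γ, killingForm ℂ L (R.vec (-(rootSystem H).root i)) a •
      R.vec ((rootSystem H).root i) := by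
  simp only [proj, LinearMap.sum_apply, LinearMap.smulRight_apply, R.vec_root, R.vec_neg_root]

theorem proj_mem_tangent (a : L) : proj R Γ a ∈ tangent Γ := by
  classical
  rw [proj_apply]
  refine Submodule.sum_mem _ fun i hi => Submodule.smul_mem _ _ ?_
  exact vec_mem_tangent R ⟨root_mem_rootSet i, (Finset.mem_filter.1 hi).2⟩

theorem killingForm_vec_neg_root {i j : H.root} (hij : j ≠ i) :
    killingForm ℂ L (R.vec (-(rootSystem H).root i)) (R.vec ((rootSystem H).root j)) = 0 := by
  refine R.killingForm_vec_vec (neg_mem_rootSet (root_mem_rootSet i)) (root_mem_rootSet j)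
    fun h => hij ?_
  exact (rootSystem H).root.injective (neg_add_eq_zero.1 h).symm

theorem killingForm_vec_proj (hx : x ∈ outerRoots Γ) (a : L) :
    killingForm ℂ L (R.vec x) (proj R Γ a) = killingForm ℂ L (R.vec x) a := by
  classical
  obtain ⟨⟨i, hix⟩, hi⟩ := neg_mem_outerRoots hx
  obtain rfl : x = -(rootSystem H).root i := by rw [hix, neg_neg]
  rw [neg_neg] at hi
  rw [proj_apply, map_sum, Finset.sum_eq_single i]
  · rw [map_smul, LieModule.traceForm_comm ℂ L L (R.vec (-_)) (R.vec _),
      R.killingForm_vec_neg (root_mem_rootSet i), smul_eq_mul, mul_one]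
  · intro j _ hj
    rw [map_smul, killingForm_vec_neg_root R hj, smul_zero]
  · exact fun h => absurd (Finset.mem_filter.2 ⟨Finset.mem_univ i, hi⟩) h

theorem proj_vec (hx : x ∈ outerRoots Γ) : proj R Γ (R.vec x) = R.vec x := by
  classical
  obtain ⟨⟨i, rfl⟩, hi⟩ := hx
  rw [proj_apply, Finset.sum_eq_single i]
  · rw [LieModule.traceForm_comm, R.killingForm_vec_neg (root_mem_rootSet i), one_smul]
  · intro j _ hj
    rw [killingForm_vec_neg_root R hj.symm, zero_smul]
  · exact fun h => absurd (Finset.mem_filter.2 ⟨Finset.mem_univ i, hi⟩) h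

theorem proj_eq_self {m : L} (hm : m ∈ tangent Γ) : proj R Γ m = m := by
  have hle : tangent Γ ≤ LinearMap.eqLocus (proj R Γ) LinearMap.id := by
    rw [tangent_eq_span R, Submodule.span_le]
    rintro _ ⟨x, hx, rfl⟩
    exact proj_vec R hx
  exact hle hm

theorem map_proj_mem_tangentPower (n : ℕ) (w : ⋀[ℂ]^n L) :
    exteriorPower.map n (proj R Γ) w ∈ tangentPower Γ n := by
  refine ⟨exteriorPower.map n ((proj R Γ).codRestrict _ (proj_mem_tangent R)) w, ?_⟩
  rw [← LinearMap.comp_apply, ← exteriorPower.map_comp, LinearMap.subtype_comp_codRestrict]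

theorem map_proj_eq_self {n : ℕ} {w : ⋀[ℂ]^n L} (hw : w ∈ tangentPower Γ n) :
    exteriorPower.map n (proj R Γ) w = w := by
  obtain ⟨u, rfl⟩ := hw
  rw [← LinearMap.comp_apply, ← exteriorPower.map_comp]
  congr 2
  ext m
  exact proj_eq_self R m.2

theorem ιMulti_mem_tangentPower {n : ℕ} {v : Fin n → L} (hv : ∀ i, v i ∈ tangent Γ) :
    exteriorPower.ιMulti ℂ n v ∈ tangentPower Γ n :=
  ⟨exteriorPower.ιMulti ℂ n fun i => ⟨v i, hv i⟩, exteriorPower.map_apply_ιMulti ..⟩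

theorem tri_map_proj (hx : x ∈ outerRoots Γ) (hy : y ∈ outerRoots Γ) (hz : z ∈ outerRoots Γ)
    (w : ⋀[ℂ]^3 L) : tri (R.vec x) (R.vec y) (R.vec z) (exteriorPower.map 3 (proj R Γ) w) =
      tri (R.vec x) (R.vec y) (R.vec z) w :=
  tri_map _ (killingForm_vec_proj R hx) (killingForm_vec_proj R hy) (killingForm_vec_proj R hz) w

end Levi

section Nondegenerate

variable {R M N ι : Type*} [CommRing R] [AddCommGroup M] [Module R M] [AddCommGroup N] [Module R N]
  [Finite ι] {n : ℕ}

theorem map_pi_eq_zero (f : ι → Module.Dual R M) {w : ⋀[R]^n M}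
    (h : ∀ s : Fin n → ι, exteriorPower.alternatingMapToDual R M n (f ∘ s) w = 0) :
    exteriorPower.map n (LinearMap.pi f) w = 0 := by
  classical
  let : LinearOrder ι := linearOrderOfSTO WellOrderingRel
  let b := Pi.basisFun R ι
  refine (b.exteriorPower n).ext_elem fun s => ?_
  have hcoord : exteriorPower.ιMultiDual R n b s ∘ₗ exteriorPower.map n (LinearMap.pi f) =
      exteriorPower.alternatingMapToDual R M n (f ∘ Set.powersetCard.ofFinEmbEquiv.symm s) := by
    refine exteriorPower.linearMap_ext (AlternatingMap.ext fun v => ?_)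
    simp [b]
  rw [exteriorPower.basis_repr_apply, map_zero, Finsupp.zero_apply, ← h, ← hcoord,
    LinearMap.comp_apply]

theorem map_sum_smulRight_eq_zero [Fintype ι] (f : ι → Module.Dual R M) (e : ι → N) {w : ⋀[R]^n M}
    (h : ∀ s : Fin n → ι, exteriorPower.alternatingMapToDual R M n (f ∘ s) w = 0) :
    exteriorPower.map n (∑ i, (f i).smulRight (e i)) w = 0 := by
  have hfactor : ∑ i, (f i).smulRight (e i) = Fintype.linearCombination R e ∘ₗ LinearMap.pi f := by
    ext m
    simp [Fintype.linearCombination_apply]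
  rw [hfactor, exteriorPower.map_comp, LinearMap.comp_apply, map_pi_eq_zero f h, map_zero]

end Nondegenerate

section Determination

variable (R : RootVectors H) {Γ : Finset H.root}

theorem eq_zero_of_tri {w : ⋀[ℂ]^3 L} (hw : w ∈ tangentPower Γ 3)
    (h : ∀ x ∈ outerRoots Γ, ∀ y ∈ outerRoots Γ, ∀ z ∈ outerRoots Γ,
      tri (R.vec x) (R.vec y) (R.vec z) w = 0) : w = 0 := by
  classical
  have hproj : proj R Γ = ∑ i : {i : H.root // i ∉ leviRoots Γ},
      (killingForm ℂ L (R.vec (-(rootSystem H).root i))).smulRight (R.E i.1.1) := by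
    simp only [proj, R.vec_neg_root]
    exact (Finset.sum_subtype _ (by simp) _)
  rw [← map_proj_eq_self R hw, hproj]
  have houter : ∀ i : {i : H.root // i ∉ leviRoots Γ}, -(rootSystem H).root i ∈ outerRoots Γ :=
    fun i => neg_mem_outerRoots ⟨root_mem_rootSet i.1, i.2⟩
  refine map_sum_smulRight_eq_zero _ _ fun s => ?_
  rw [← h _ (houter (s 0)) _ (houter (s 1)) _ (houter (s 2)), tri]
  congr 2
  funext i
  fin_cases i <;> rfl

theorem eq_of_tri {v w : ⋀[ℂ]^3 L} (hv : v ∈ tangentPower Γ 3) (hw : w ∈ tangentPower Γ 3)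
    (h : ∀ x ∈ outerRoots Γ, ∀ y ∈ outerRoots Γ, ∀ z ∈ outerRoots Γ,
      tri (R.vec x) (R.vec y) (R.vec z) v = tri (R.vec x) (R.vec y) (R.vec z) w) : v = w := by
  rw [← sub_eq_zero]
  refine eq_zero_of_tri R (sub_mem hv hw) fun x hx y hy z hz => ?_
  rw [map_sub, h x hx y hy z hz, sub_self]

end Determination

/-! ### Invariant bivectors and good orbits -/

theorem tri_schouten_of_sharp_eq_smul {L : Type*} [LieRing L] [LieAlgebra ℂ L] {f g : ⋀[ℂ]^2 L}
    {a b c : L} {p q r p' q' r' : ℂ}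
    (ha : sharp f a = p • a) (hb : sharp f b = q • b) (hc : sharp f c = r • c)
    (ha' : sharp g a = p' • a) (hb' : sharp g b = q' • b) (hc' : sharp g c = r' • c) :
    tri a b c (schouten f g) =
      (p * q' + p' * q + q * r' + q' * r + r * p' + r' * p) * killingForm ℂ L ⁅a, b⁆ c := by
  have h₁ : killingForm ℂ L a ⁅b, c⁆ = killingForm ℂ L ⁅a, b⁆ c :=
    (LieModule.traceForm_apply_lie_apply ..).symm
  have h₂ : killingForm ℂ L b ⁅c, a⁆ = killingForm ℂ L ⁅a, b⁆ c := by
    rw [← LieModule.traceForm_apply_lie_apply, LieModule.traceForm_comm, h₁]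
  rw [tri_schouten, ha, hb, hc, ha', hb', hc']
  simp only [smul_lie, lie_smul, map_add, map_smul, smul_eq_mul, h₁, h₂,
    LieModule.traceForm_comm ℂ L L c ⁅a, b⁆]
  ring

section RMatrix

variable (R : RootVectors H) {Γ : Finset H.root} {b : (rootSystem H).Base}
  {x y z : Module.Dual ℂ H}

open Classical in
theorem sharp_wedge₂_vec (i j : H.root) :
    sharp (wedge₂ (R.E j.1) (R.E (-j.1))) (R.vec ((rootSystem H).root i)) =
      ((if i = j then 1 else 0 : ℂ) - if negRoot i = j then 1 else 0) •
        R.vec ((rootSystem H).root i) := by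
  have hpos : killingForm ℂ L (R.vec ((rootSystem H).root i)) (R.vec (-(rootSystem H).root j)) •
      R.vec ((rootSystem H).root j) =
        (if i = j then 1 else 0 : ℂ) • R.vec ((rootSystem H).root i) := by
    split_ifs with h
    · rw [← h, R.killingForm_vec_neg (root_mem_rootSet i)]
    · rw [LieModule.traceForm_comm, killingForm_vec_neg_root R h, zero_smul, zero_smul]
  have hneg : killingForm ℂ L (R.vec ((rootSystem H).root i)) (R.vec ((rootSystem H).root j)) •
      R.vec (-(rootSystem H).root j) =
        (if negRoot i = j then 1 else 0 : ℂ) • R.vec ((rootSystem H).root i) := by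
    split_ifs with h
    · rw [← h, root_negRoot, R.killingForm_vec_neg (root_mem_rootSet i), neg_neg]
    · have h₀ := killingForm_vec_neg_root R (Ne.symm h)
      rw [root_negRoot, neg_neg] at h₀
      rw [h₀, zero_smul, zero_smul]
  rw [sharp_wedge₂, ← R.vec_root, ← R.vec_neg_root, hpos, hneg, sub_smul]

theorem sharp_sum_vec {s : Finset H.root} {t : H.root → ℂ} {i : H.root}
    (hs : negRoot i ∈ s ↔ i ∉ s) (ht : t (negRoot i) = -t i) :
    sharp (∑ j ∈ s, t j • wedge₂ (R.E j.1) (R.E (-j.1))) (R.vec ((rootSystem H).root i)) =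
      t i • R.vec ((rootSystem H).root i) := by
  classical
  rw [map_sum, LinearMap.sum_apply]
  simp only [map_smul, LinearMap.smul_apply, sharp_wedge₂_vec, smul_smul, ← Finset.sum_smul,
    mul_sub, mul_ite, mul_one, mul_zero, Finset.sum_sub_distrib, Finset.sum_ite_eq, hs, ht]
  split_ifs <;> simp

theorem height_negRoot (i : H.root) : b.height (negRoot i) = -b.height i := by
  have h := b.height_add_zsmul (i := i) (j := i) (k := negRoot i) (z := -2)
    (by rw [root_negRoot]; module)
  rw [h, smul_eq_mul]
  ring

theorem isPos_negRoot_iff (i : H.root) : b.IsPos (negRoot i) ↔ ¬ b.IsPos i := by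
  rw [b.isPos_iff, b.isPos_iff, height_negRoot]
  have := b.height_ne_zero i
  omega

theorem negRoot_mem_leviRoots_iff {i : H.root} : negRoot i ∈ leviRoots Γ ↔ i ∈ leviRoots Γ := by
  change (rootSystem H).root (negRoot i) ∈ leviSpan Γ ↔ (rootSystem H).root i ∈ leviSpan Γ
  rw [root_negRoot, (leviSpan Γ).neg_mem_iff]

theorem sharp_rMatrix (i : H.root) : sharp (rMatrix R b) (R.vec ((rootSystem H).root i)) =
    ((b.height i).sign : ℂ) • R.vec ((rootSystem H).root i) := by
  classical
  have hr : rMatrix R b = ∑ j : H.root with b.IsPos j,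
      ((b.height j).sign : ℂ) • wedge₂ (R.E j.1) (R.E (-j.1)) := by
    refine Finset.sum_congr rfl fun j hj => ?_
    rw [Int.sign_eq_one_of_pos (b.isPos_iff.1 (Finset.mem_filter.1 hj).2), Int.cast_one, one_smul]
  rw [hr]
  refine sharp_sum_vec R ?_ ?_
  · simp only [Finset.mem_filter, Finset.mem_univ, true_and, isPos_negRoot_iff]
  · rw [height_negRoot, Int.sign_neg, Int.cast_neg]

theorem sharp_kks (t : H) (hx : x ∈ outerRoots Γ) :
    sharp (kks R b Γ t) (R.vec x) = (x t)⁻¹ • R.vec x := by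
  obtain ⟨⟨i, rfl⟩, hi⟩ := hx
  refine sharp_sum_vec R (t := fun j => (j.1 t)⁻¹) ?_ inv_neg
  have hi' : i ∉ leviRoots Γ := hi
  simp only [Finset.mem_filter, Finset.mem_univ, true_and, isPos_negRoot_iff,
    negRoot_mem_leviRoots_iff, hi', not_false_eq_true, and_true]

theorem sign_mul_sum_of_add_eq_zero {a b c : ℤ} (ha : a ≠ 0) (hb : b ≠ 0) (hc : c ≠ 0)
    (h : a + b + c = 0) : a.sign * b.sign + b.sign * c.sign + c.sign * a.sign = -1 := by
  rcases lt_or_gt_of_ne ha with ha | ha <;> rcases lt_or_gt_of_ne hb with hb | hb <;>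
    rcases lt_or_gt_of_ne hc with hc | hc <;>
    simp only [Int.sign_eq_one_of_pos, Int.sign_eq_neg_one_of_neg, *] <;> omega

theorem tri_phi (hx : x ∈ rootSet H) (hy : y ∈ rootSet H) (hz : z ∈ rootSet H) :
    tri (R.vec x) (R.vec y) (R.vec z) (phi R b) =
      -2 * killingForm ℂ L ⁅R.vec x, R.vec y⁆ (R.vec z) := by
  by_cases h : x + y + z = 0
  · obtain ⟨i, rfl⟩ := hx
    obtain ⟨j, rfl⟩ := hy
    obtain ⟨k, rfl⟩ := hz
    have hk : b.height (negRoot k) = b.height i + b.height j :=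
      b.height_add (by rw [root_negRoot]; exact (eq_neg_of_add_eq_zero_left h).symm)
    rw [height_negRoot] at hk
    have hsign := congrArg (Int.cast : ℤ → ℂ) <| sign_mul_sum_of_add_eq_zero
      (b.height_ne_zero i) (b.height_ne_zero j) (b.height_ne_zero k) (by omega)
    push_cast at hsign
    rw [phi, tri_schouten_of_sharp_eq_smul (sharp_rMatrix R i) (sharp_rMatrix R j)
      (sharp_rMatrix R k) (sharp_rMatrix R i) (sharp_rMatrix R j) (sharp_rMatrix R k)]
    linear_combination 2 * killingForm ℂ L
      ⁅R.vec ((rootSystem H).root i), R.vec ((rootSystem H).root j)⁆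
      (R.vec ((rootSystem H).root k)) * hsign
  · have h₀ := R.killingForm_eq_zero (R.lie_vec_mem hx hy) hz h
    obtain ⟨i, rfl⟩ := hx
    obtain ⟨j, rfl⟩ := hy
    obtain ⟨k, rfl⟩ := hz
    rw [phi, tri_schouten_of_sharp_eq_smul (sharp_rMatrix R i) (sharp_rMatrix R j)
      (sharp_rMatrix R k) (sharp_rMatrix R i) (sharp_rMatrix R j) (sharp_rMatrix R k), h₀,
      mul_zero, mul_zero]

end RMatrix

section Eigenvalue

variable (R : RootVectors H) {Γ : Finset H.root} {b : (rootSystem H).Base}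
  {x y z : Module.Dual ℂ H}

/-- The eigenvalue of a bivector on a root vector: `f♯ E_x = eigen f x • E_x` when `f` is
invariant under the Cartan subalgebra. -/
def eigen (f : ⋀[ℂ]^2 L) (x : Module.Dual ℂ H) : ℂ :=
  killingForm ℂ L (sharp f (R.vec x)) (R.vec (-x))

theorem eigen_neg (f : ⋀[ℂ]^2 L) : eigen R f (-x) = -eigen R f x := by
  rw [eigen, killingForm_sharp, neg_neg, LieModule.traceForm_comm, eigen]

theorem adExt_eq_zero {n : ℕ} {w : ⋀[ℂ]^n L} (hw : w ∈ invariants Γ n) {a : L} (ha : a ∈ levi Γ) :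
    adExt n a w = 0 :=
  (Submodule.mem_iInf _).1 hw.2 ⟨a, ha⟩

theorem killingForm_lie_vec_ne_zero (hs : b.cartanMatrix.IsSymm)
    (hx : x ∈ rootSet H) (hy : y ∈ rootSet H) (hz : z ∈ rootSet H) (h : x + y + z = 0) :
    killingForm ℂ L ⁅R.vec x, R.vec y⁆ (R.vec z) ≠ 0 := by
  have hxy : x + y = -z := eq_neg_of_add_eq_zero_left h
  have hm : x + y ∈ rootSet H := hxy ▸ neg_mem_rootSet hz
  intro h0
  refine R.lie_vec_ne_zero hs hx hy hm ?_
  rw [R.lie_vec_eq_smul hx hy hm, hxy, neg_neg, h0, zero_smul]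

theorem apply_eq_zero_of_mem_leviSpan {t : H} (ht : IsBasePoint Γ t) (hx : x ∈ leviSpan Γ) :
    x t = 0 := by
  have hle : leviSpan Γ ≤ LinearMap.ker (LinearMap.applyₗ t) := by
    rw [leviSpan, Submodule.span_le]
    rintro _ ⟨i, hi, rfl⟩
    exact ht.1 i hi
  exact hle hx

theorem apply_ne_zero_of_mem_outerRoots {t : H} (ht : IsBasePoint Γ t) (hx : x ∈ outerRoots Γ) :
    x t ≠ 0 := by
  obtain ⟨⟨i, rfl⟩, hi⟩ := hx
  exact ht.2 i hi

variable {f : ⋀[ℂ]^2 L} (hf : f ∈ invariants Γ 2)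
include hf

theorem sharp_vec (hx : x ∈ rootSet H) : sharp f (R.vec x) = eigen R f x • R.vec x := by
  refine R.eq_smul_vec hx (weightSpace_le_genWeightSpace L _ ?_)
  rw [mem_weightSpace]
  intro h
  have h₁ := sharp_adExt (h : L) f (R.vec x)
  rw [adExt_eq_zero hf (cartan_le_levi h.2), map_zero, LinearMap.zero_apply, R.lie_vec hx h.2,
    map_smul, eq_comm, sub_eq_zero] at h₁
  exact h₁

variable (hs : b.cartanMatrix.IsSymm)
include hs

theorem eigen_add (hΓ : Γ ⊆ b.support) (hx : x ∈ rootSet H) (hy : y ∈ rootSet H)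
    (hxy : x + y ∈ rootSet H) (hxΓ : x ∈ leviSpan Γ) : eigen R f (x + y) = eigen R f y := by
  have h₁ := sharp_adExt (R.vec x) f (R.vec y)
  have hne := R.lie_vec_ne_zero hs hx hy hxy
  rw [adExt_eq_zero hf (vec_mem_levi R hs hΓ hx hxΓ), map_zero, LinearMap.zero_apply,
    sharp_vec R hf hy, lie_smul, R.lie_vec_eq_smul hx hy hxy, map_smul, sharp_vec R hf hxy,
    smul_comm, ← smul_sub, ← sub_smul] at h₁
  rw [R.lie_vec_eq_smul hx hy hxy] at hne
  have h₂ := (smul_eq_zero.1 h₁.symm).resolve_left (smul_ne_zero_iff.1 hne).1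
  exact (sub_eq_zero.1 ((smul_eq_zero.1 h₂).resolve_right (R.vec_ne_zero hxy))).symm

theorem eigen_mul_sum (hx : x ∈ outerRoots Γ) (hy : y ∈ outerRoots Γ) (hz : z ∈ outerRoots Γ)
    (h : x + y + z = 0) {K : ℂ} (hK : schoutenM R Γ f f = K ^ 2 • phiM R b Γ) :
    eigen R f x * eigen R f y + eigen R f y * eigen R f z + eigen R f z * eigen R f x =
      -K ^ 2 := by
  have h₁ := congrArg (tri (R.vec x) (R.vec y) (R.vec z)) hK
  rw [schoutenM, phiM, map_smul, tri_map_proj R hx hy hz, tri_map_proj R hx hy hz,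
    tri_phi R hx.1 hy.1 hz.1, tri_schouten_of_sharp_eq_smul (sharp_vec R hf hx.1)
    (sharp_vec R hf hy.1) (sharp_vec R hf hz.1) (sharp_vec R hf hx.1)
    (sharp_vec R hf hy.1) (sharp_vec R hf hz.1), smul_eq_mul] at h₁
  refine mul_right_cancel₀ (killingForm_lie_vec_ne_zero R hs hx.1 hy.1 hz.1 h) ?_
  linear_combination h₁ / 2

theorem eigen_mul_sq_sum (hx : x ∈ outerRoots Γ) (hy : y ∈ outerRoots Γ) (hz : z ∈ outerRoots Γ)
    (h : x + y + z = 0) {t : H} (ht : IsBasePoint Γ t)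
    (hkks : schoutenM R Γ f (kks R b Γ t) = 0) :
    eigen R f x * x t ^ 2 + eigen R f y * y t ^ 2 + eigen R f z * z t ^ 2 = 0 := by
  have h₁ := congrArg (tri (R.vec x) (R.vec y) (R.vec z)) hkks
  rw [schoutenM, map_zero, tri_map_proj R hx hy hz, tri_schouten_of_sharp_eq_smul
    (sharp_vec R hf hx.1) (sharp_vec R hf hy.1) (sharp_vec R hf hz.1) (sharp_kks R t hx)
    (sharp_kks R t hy) (sharp_kks R t hz)] at h₁
  have h₂ := (mul_eq_zero.1 h₁).resolve_right (killingForm_lie_vec_ne_zero R hs hx.1 hy.1 hz.1 h)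
  have hzt : z t = -(x t + y t) := by
    rw [eq_neg_of_add_eq_zero_right h]; rfl
  have hxt := apply_ne_zero_of_mem_outerRoots ht hx
  have hyt := apply_ne_zero_of_mem_outerRoots ht hy
  have hzt₀ := apply_ne_zero_of_mem_outerRoots ht hz
  field_simp at h₂
  rw [hzt] at h₂ ⊢
  linear_combination -h₂

end Eigenvalue

section GoodOrbit

variable (R : RootVectors H) {Γ : Finset H.root} {b : (rootSystem H).Base}
  {x y : Module.Dual ℂ H}

open Classical in
/-- The function `x ↦ x(t)² f(x)` on the roots outside `Ω_Γ`, where `f(x)` is the eigenvalue of the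
bivector `f` at `x`, extended by zero to `Ω_Γ`. It is additive when `f` is compatible with the
bivector of the orbit through `t`. -/
def eigenScaled (Γ : Finset H.root) (f : ⋀[ℂ]^2 L) (t : H) (x : Module.Dual ℂ H) : ℂ :=
  if x ∈ leviSpan Γ then 0 else x t ^ 2 * eigen R f x

theorem eigenScaled_neg (f : ⋀[ℂ]^2 L) (t : H) :
    eigenScaled R Γ f t (-x) = -eigenScaled R Γ f t x := by
  rw [eigenScaled, eigenScaled, (leviSpan Γ).neg_mem_iff]
  split_ifs
  · rw [neg_zero]
  · rw [eigen_neg, LinearMap.neg_apply]; ring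

variable {t : H} (ht : IsBasePoint Γ t) {f : ⋀[ℂ]^2 L} (hf : f ∈ invariants Γ 2)
  (hs : b.cartanMatrix.IsSymm)
include ht hf hs

theorem eigenScaled_add_of_mem_leviSpan (hΓ : Γ ⊆ b.support) (hx : x ∈ rootSet H)
    (hy : y ∈ rootSet H) (hxy : x + y ∈ rootSet H) (hxΓ : x ∈ leviSpan Γ) :
    eigenScaled R Γ f t (x + y) = eigenScaled R Γ f t x + eigenScaled R Γ f t y := by
  rw [eigenScaled, eigenScaled, eigenScaled, (leviSpan Γ).add_mem_iff_right hxΓ, if_pos hxΓ,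
    zero_add, eigen_add R hf hs hΓ hx hy hxy hxΓ, LinearMap.add_apply,
    apply_eq_zero_of_mem_leviSpan ht hxΓ, zero_add]

variable (hkks : schoutenM R Γ f (kks R b Γ t) = 0)
include hkks

theorem eigenScaled_add (hΓ : Γ ⊆ b.support) (hx : x ∈ rootSet H) (hy : y ∈ rootSet H)
    (hxy : x + y ∈ rootSet H) :
    eigenScaled R Γ f t (x + y) = eigenScaled R Γ f t x + eigenScaled R Γ f t y := by
  by_cases hxΓ : x ∈ leviSpan Γ
  · exact eigenScaled_add_of_mem_leviSpan R ht hf hs hΓ hx hy hxy hxΓ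
  by_cases hyΓ : y ∈ leviSpan Γ
  · rw [add_comm] at hxy
    rw [add_comm, eigenScaled_add_of_mem_leviSpan R ht hf hs hΓ hy hx hxy hyΓ, add_comm]
  by_cases hxyΓ : x + y ∈ leviSpan Γ
  · have h := eigenScaled_add_of_mem_leviSpan R ht hf hs hΓ hxy (neg_mem_rootSet hx)
      (by simpa using hy) hxyΓ
    rw [add_neg_cancel_comm, eigenScaled_neg] at h
    rw [h]; ring
  · have h := eigen_mul_sq_sum R hf hs ⟨hx, hxΓ⟩ ⟨hy, hyΓ⟩ (neg_mem_outerRoots ⟨hxy, hxyΓ⟩)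
      (add_neg_cancel _) ht hkks
    rw [eigen_neg, LinearMap.neg_apply] at h
    rw [eigenScaled, eigenScaled, eigenScaled, if_neg hxΓ, if_neg hyΓ, if_neg hxyΓ]
    linear_combination -h

theorem exists_linear_eq_eigenScaled (hΓ : Γ ⊆ b.support) :
    ∃ G : Module.Dual ℂ H →ₗ[ℂ] ℂ, ∀ x ∈ rootSet H, G x = eigenScaled R Γ f t x := by
  let G := b.toWeightBasis.constr ℂ fun i => eigenScaled R Γ f t ((rootSystem H).root i)
  have hG : ∀ i : b.support, G ((rootSystem H).root i) =
      eigenScaled R Γ f t ((rootSystem H).root i) := fun i => by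
    rw [← b.toWeightBasis_apply, Module.Basis.constr_basis, b.toWeightBasis_apply]
  refine ⟨G, fun x hx => ?_⟩
  rcases (isBased_range_root b).induction (fun x => G x = eigenScaled R Γ f t x) hG
    (fun x hx i ih hxi => by
      rw [map_add, ih, hG,
        eigenScaled_add R ht hf hs hkks hΓ hx (root_mem_rootSet _) hxi]) x hx with h | h
  · exact h
  · rwa [map_neg, eigenScaled_neg, neg_inj] at h

theorem isCompatible_of_linear_eq_eigenScaled {G : Module.Dual ℂ H →ₗ[ℂ] ℂ}
    (hG : ∀ x ∈ rootSet H, G x = eigenScaled R Γ f t x) {K : ℂ}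
    (hK : schoutenM R Γ f f = K ^ 2 • phiM R b Γ) (hx : x ∈ rootSet H) (hy : y ∈ rootSet H)
    (hxy : x + y ∈ rootSet H) :
    IsCompatible (LinearMap.applyₗ t).toAddMonoidHom G.toAddMonoidHom K x y := by
  change (G x * y t - G y * x t) ^ 2 = (K * (x t * y t * (x + y) t)) ^ 2
  have hzero : ∀ x ∈ rootSet H, x ∈ leviSpan Γ → x t = 0 ∧ G x = 0 := fun x hx hxΓ =>
    ⟨apply_eq_zero_of_mem_leviSpan ht hxΓ, by rw [hG x hx, eigenScaled, if_pos hxΓ]⟩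
  by_cases hxΓ : x ∈ leviSpan Γ
  · rw [(hzero x hx hxΓ).1, (hzero x hx hxΓ).2]; ring
  by_cases hyΓ : y ∈ leviSpan Γ
  · rw [(hzero y hy hyΓ).1, (hzero y hy hyΓ).2]; ring
  by_cases hxyΓ : x + y ∈ leviSpan Γ
  · obtain ⟨h₁, h₂⟩ := hzero _ hxy hxyΓ
    rw [h₁]
    rw [LinearMap.add_apply] at h₁
    rw [map_add] at h₂
    linear_combination (G x * y t - G y * x t) * (y t * h₂ - G y * h₁)
  · have hz := neg_mem_outerRoots ⟨hxy, hxyΓ⟩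
    have h₁ := eigen_mul_sum R hf hs ⟨hx, hxΓ⟩ ⟨hy, hyΓ⟩ hz (add_neg_cancel _) hK
    have h₂ := eigen_mul_sq_sum R hf hs ⟨hx, hxΓ⟩ ⟨hy, hyΓ⟩ hz (add_neg_cancel _) ht hkks
    rw [eigen_neg] at h₁ h₂
    rw [LinearMap.neg_apply, LinearMap.add_apply] at h₂
    rw [hG x hx, hG y hy, LinearMap.add_apply, eigenScaled, eigenScaled, if_neg hxΓ, if_neg hyΓ]
    linear_combination (x t * y t) ^ 2 * (-(x t + y t) ^ 2 * h₁ +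
      (eigen R f x + eigen R f y) * h₂)

theorem exists_isGoodPair (hΓ : Γ ⊆ b.support) {K : ℂ}
    (hK : schoutenM R Γ f f = K ^ 2 • phiM R b Γ) :
    ∃ lam g : Module.Dual ℂ H →+ ℂ, IsGoodPair (rootSet H) lam g K ∧
      IsAdapted (rootSet H) (fun i : b.support => (rootSystem H).root i) (baseCoord b)
        {i : b.support | (i : H.root) ∈ Γ} lam g := by
  obtain ⟨G, hG⟩ := exists_linear_eq_eigenScaled R ht hf hs hkks hΓ
  have hsimple : ∀ i : b.support, (i : H.root) ∈ Γ → (rootSystem H).root i ∈ leviSpan Γ :=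
    fun i hi => Submodule.subset_span ⟨i, hi, rfl⟩
  refine ⟨(LinearMap.applyₗ t).toAddMonoidHom, G.toAddMonoidHom, fun x hx y hy hxy =>
    isCompatible_of_linear_eq_eigenScaled R ht hf hs hkks hG hK hx hy hxy, ⟨?_, ?_, ?_⟩⟩
  · exact fun i hi => apply_eq_zero_of_mem_leviSpan ht (hsimple i hi)
  · intro i hi
    exact (hG _ (root_mem_rootSet _)).trans (if_pos (hsimple i hi))
  · exact fun x hx i hi hc => apply_ne_zero_of_mem_outerRoots ht
      ⟨hx, fun hxΓ => hc ((mem_leviSpan_iff hΓ hx).1 hxΓ i hi)⟩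

end GoodOrbit

/-! ### Invariant trivectors -/

section Trivectors

variable (R : RootVectors H) {Γ : Finset H.root} {b : (rootSystem H).Base}
  {x y z : Module.Dual ℂ H}

theorem tri_phiM_vec (hx : x ∈ outerRoots Γ) (hy : y ∈ outerRoots Γ) (hz : z ∈ outerRoots Γ) :
    tri (R.vec x) (R.vec y) (R.vec z) (phiM R b Γ) =
      -2 * killingForm ℂ L ⁅R.vec x, R.vec y⁆ (R.vec z) :=
  (tri_map_proj R hx hy hz _).trans (tri_phi R hx.1 hy.1 hz.1)

include R in
theorem tri_eq_of_vec {w : ⋀[ℂ]^3 L} {m₁ m₂ m₃ : L} {F : L →ₗ[ℂ] ℂ}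
    (h : ∀ x ∈ outerRoots Γ, tri (R.vec x) m₂ m₃ w = F (R.vec x)) (hm₁ : m₁ ∈ tangent Γ) :
    tri m₁ m₂ m₃ w = F m₁ := by
  let T : L →ₗ[ℂ] ℂ :=
    { toFun := fun m => tri m m₂ m₃ w
      map_add' := fun _ _ => tri_add_left ..
      map_smul' := fun _ _ => tri_smul_left .. }
  have hle : tangent Γ ≤ LinearMap.eqLocus T F := by
    rw [tangent_eq_span R, Submodule.span_le]
    rintro _ ⟨x, hx, rfl⟩
    exact h x hx
  exact hle hm₁

theorem tri_phiM {m₁ m₂ m₃ : L} (h₁ : m₁ ∈ tangent Γ) (h₂ : m₂ ∈ tangent Γ)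
    (h₃ : m₃ ∈ tangent Γ) :
    tri m₁ m₂ m₃ (phiM R b Γ) = -2 * killingForm ℂ L ⁅m₁, m₂⁆ m₃ := by
  have rotate : ∀ u v w : L, tri u v w (phiM R b Γ) = -2 * killingForm ℂ L ⁅u, v⁆ w →
      tri v w u (phiM R b Γ) = -2 * killingForm ℂ L ⁅v, w⁆ u := fun u v w h => by
    rw [tri_rotate, h, LieModule.traceForm_apply_lie_apply, LieModule.traceForm_comm]
  have extend : ∀ v w : L, (∀ x ∈ outerRoots Γ, tri (R.vec x) v w (phiM R b Γ) =
      -2 * killingForm ℂ L ⁅R.vec x, v⁆ w) → ∀ u ∈ tangent Γ,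
        tri u v w (phiM R b Γ) = -2 * killingForm ℂ L ⁅u, v⁆ w := fun v w h u hu => by
    let F : L →ₗ[ℂ] ℂ := -2 • killingForm ℂ L ⁅v, w⁆
    have hF : ∀ m, F m = -2 * killingForm ℂ L ⁅m, v⁆ w := fun m => by
      rw [LieModule.traceForm_apply_lie_apply, LieModule.traceForm_comm]
      simp [F]
    rw [← hF]
    exact tri_eq_of_vec R (fun x hx => (h x hx).trans (hF _).symm) hu
  refine extend _ _ (fun x hx => rotate _ _ _ (rotate _ _ _ ?_)) _ h₁
  refine extend _ _ (fun y hy => rotate _ _ _ (rotate _ _ _ ?_)) _ h₂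
  exact extend _ _ (fun z hz => tri_phiM_vec R hz hx hy) _ h₃

include R in
theorem adExt_mem_tangentPower {n : ℕ} {a : L} (ha : a ∈ levi Γ) {w : ⋀[ℂ]^n L}
    (hw : w ∈ tangentPower Γ n) : adExt n a w ∈ tangentPower Γ n := by
  rw [← map_proj_eq_self R hw]
  clear hw
  induction w using polyvector_induction with
  | ιMulti v =>
    rw [exteriorPower.map_apply_ιMulti, adExt_ιMulti]
    refine Submodule.sum_mem _ fun i _ => ιMulti_mem_tangentPower fun j => ?_
    have hp := fun i => proj_mem_tangent (Γ := Γ) R (v i)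
    rcases eq_or_ne j i with rfl | hji
    · simpa using lie_mem_tangent R ha (hp j)
    · simpa [hji] using hp j
  | add v w hv hw => simp only [map_add, add_mem hv hw]
  | smul c v hv => simp only [map_smul, Submodule.smul_mem _ c hv]

theorem phiM_mem_invariants : phiM R b Γ ∈ invariants Γ 3 := by
  have hm : phiM R b Γ ∈ tangentPower Γ 3 := map_proj_mem_tangentPower R 3 _
  refine ⟨hm, (Submodule.mem_iInf _).2 fun a => ?_⟩
  refine eq_zero_of_tri R (adExt_mem_tangentPower R a.2 hm) fun x hx y hy z hz => ?_
  have h₁ := vec_mem_tangent R hx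
  have h₂ := vec_mem_tangent R hy
  have h₃ := vec_mem_tangent R hz
  rw [tri_adExt, tri_phiM R (lie_mem_tangent R a.2 h₁) h₂ h₃,
    tri_phiM R h₁ (lie_mem_tangent R a.2 h₂) h₃, tri_phiM R h₁ h₂ (lie_mem_tangent R a.2 h₃)]
  have h := killingForm_lie_left (a : L) ⁅R.vec x, R.vec y⁆ (R.vec z)
  rw [leibniz_lie, map_add, LinearMap.add_apply] at h
  linear_combination 2 * h

section Automorphism

variable {θ : L ≃ₗ⁅ℂ⁆ L}

omit [FiniteDimensional ℂ L] [IsSimple ℂ L] [H.IsCartanSubalgebra] in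
theorem IsCartanAutomorphism.symm (hθ : IsCartanAutomorphism H θ) :
    IsCartanAutomorphism H θ.symm := fun x hx => by
  have h := hθ _ (H.neg_mem hx)
  rw [neg_neg] at h
  rw [← θ.symm_apply_apply (-x), h]

omit [FiniteDimensional ℂ L] [IsSimple ℂ L] [H.IsCartanSubalgebra] in
theorem tri_map_equiv (u v m : L) (w : ⋀[ℂ]^3 L) :
    tri (θ u) (θ v) (θ m) (exteriorPower.map 3 (θ : L →ₗ[ℂ] L) w) = tri u v m w :=
  tri_map _ (killingForm_of_equiv_apply θ u) (killingForm_of_equiv_apply θ v)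
    (killingForm_of_equiv_apply θ m) w

variable (hθ : IsCartanAutomorphism H θ)
include hθ

theorem exists_map_vec_eq_smul (hx : x ∈ rootSet H) : ∃ k : ℂ, θ (R.vec x) = k • R.vec (-x) := by
  refine ⟨_, R.eq_smul_vec (neg_mem_rootSet hx) (weightSpace_le_genWeightSpace L _ ?_)⟩
  rw [mem_weightSpace]
  intro h
  have hθh : (h : L) = θ (-(h : L)) := by rw [map_neg, hθ _ h.2, neg_neg]
  change ⁅(h : L), θ (R.vec x)⁆ = _
  rw [hθh, ← LieEquiv.map_lie, neg_lie, R.lie_vec hx h.2, map_neg, map_smul, LinearMap.neg_apply,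
    neg_smul]

include R

theorem map_mem_tangent {m : L} (hm : m ∈ tangent Γ) : θ m ∈ tangent Γ := by
  have hle : tangent Γ ≤ (tangent Γ).comap (θ : L →ₗ[ℂ] L) := by
    rw [tangent_eq_span R, Submodule.span_le, ← tangent_eq_span R]
    rintro _ ⟨x, hx, rfl⟩
    obtain ⟨k, hk⟩ := exists_map_vec_eq_smul R hθ hx.1
    change θ (R.vec x) ∈ tangent Γ
    rw [hk]
    exact Submodule.smul_mem _ _ (vec_mem_tangent R (neg_mem_outerRoots hx))
  exact hle hm

theorem map_mem_tangentPower {n : ℕ} {w : ⋀[ℂ]^n L} (hw : w ∈ tangentPower Γ n) :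
    exteriorPower.map n (θ : L →ₗ[ℂ] L) w ∈ tangentPower Γ n := by
  obtain ⟨u, rfl⟩ := hw
  refine ⟨exteriorPower.map n ((θ : L →ₗ[ℂ] L).restrict fun _ => map_mem_tangent R hθ) u, ?_⟩
  rw [← LinearMap.comp_apply, ← LinearMap.comp_apply, ← exteriorPower.map_comp,
    ← exteriorPower.map_comp]
  rfl

theorem phiM_mem_thetaInvariants : phiM R b Γ ∈ thetaInvariants Γ θ 3 := by
  have hm : phiM R b Γ ∈ tangentPower Γ 3 := map_proj_mem_tangentPower R 3 _
  refine ⟨phiM_mem_invariants R, ?_⟩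
  refine eq_of_tri R (map_mem_tangentPower R hθ hm) hm fun x hx y hy z hz => ?_
  have h₁ := vec_mem_tangent R hx
  have h₂ := vec_mem_tangent R hy
  have h₃ := vec_mem_tangent R hz
  have hsymm := fun {m : L} (hm : m ∈ tangent Γ) => map_mem_tangent R hθ.symm hm
  have h := tri_map_equiv (θ := θ) (θ.symm (R.vec x)) (θ.symm (R.vec y)) (θ.symm (R.vec z))
    (phiM R b Γ)
  rw [tri_phiM R (hsymm h₁) (hsymm h₂) (hsymm h₃), ← LieEquiv.map_lie, killingForm_of_equiv_apply,
    θ.apply_symm_apply, θ.apply_symm_apply, θ.apply_symm_apply] at h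
  exact h.trans (tri_phiM R h₁ h₂ h₃).symm

theorem exists_tri_vec_neg_eq_mul (hx : x ∈ rootSet H) (hy : y ∈ rootSet H) (hz : z ∈ rootSet H) :
    ∃ c : ℂ, ∀ w ∈ thetaInvariants Γ θ 3, tri (R.vec (-x)) (R.vec (-y)) (R.vec (-z)) w =
      c * tri (R.vec x) (R.vec y) (R.vec z) w := by
  obtain ⟨p, hp⟩ := exists_map_vec_eq_smul R hθ (neg_mem_rootSet hx)
  obtain ⟨q, hq⟩ := exists_map_vec_eq_smul R hθ (neg_mem_rootSet hy)
  obtain ⟨r, hr⟩ := exists_map_vec_eq_smul R hθ (neg_mem_rootSet hz)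
  refine ⟨p * (q * r), fun w hw => ?_⟩
  have hw' : exteriorPower.map 3 (θ : L →ₗ[ℂ] L) w = w := hw.2
  rw [← tri_map_equiv (θ := θ), hw', hp, hq, hr, tri_smul_left, tri_smul_mid, tri_smul_right,
    neg_neg, neg_neg, neg_neg, mul_assoc, mul_assoc]

end Automorphism

theorem tri_vec_eq_zero {w : ⋀[ℂ]^3 L} (hw : w ∈ invariants Γ 3) (hx : x ∈ rootSet H)
    (hy : y ∈ rootSet H) (hz : z ∈ rootSet H) (h : x + y + z ≠ 0) :
    tri (R.vec x) (R.vec y) (R.vec z) w = 0 := by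
  obtain ⟨t, ht⟩ : ∃ t, (x + y + z) t ≠ 0 := by
    by_contra! hcon
    exact h (LinearMap.ext hcon)
  have had := tri_adExt (t : L) (R.vec x) (R.vec y) (R.vec z) w
  rw [adExt_eq_zero hw (cartan_le_levi t.2), map_zero, R.lie_vec hx t.2, R.lie_vec hy t.2,
    R.lie_vec hz t.2, tri_smul_left, tri_smul_mid, tri_smul_right] at had
  refine (mul_eq_zero.1 (?_ : (x + y + z) t * _ = 0)).resolve_left ht
  rw [LinearMap.add_apply, LinearMap.add_apply]
  linear_combination had

variable (hs : b.cartanMatrix.IsSymm)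
include hs

theorem add_notMem_rootSet_of_move (hx : x ∈ rootSet H) (hy : y ∈ rootSet H) (hz : z ∈ rootSet H)
    (h : x + y + z = 0) {δ : Module.Dual ℂ H} (hδ : δ ∈ rootSet H) (hxδ : x + δ ∈ rootSet H)
    (hyδ : y - δ ∈ rootSet H) : δ + z ∉ rootSet H := fun hzδ => by
  have hB := isSimplyLaced_range_root hs
  have hBz := hB.eq_neg_one_of_add_mem hδ hz hzδ
  rw [hB.symm, eq_neg_of_add_eq_zero_right h, map_neg, map_add, AddMonoidHom.neg_apply,
    AddMonoidHom.add_apply, hB.eq_neg_one_of_add_mem hx hδ hxδ,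
    hB.eq_one_of_sub_mem hy hδ hyδ] at hBz
  norm_num at hBz

/-- As `z + δ` is not a root, the action of `E_δ` on `E_x ∧ E_{y - δ} ∧ E_z` involves only
`E_{x + δ} ∧ E_{y - δ} ∧ E_z` and `E_x ∧ E_y ∧ E_z`. -/
theorem exists_tri_vec_move_eq_mul (hΓ : Γ ⊆ b.support) (hx : x ∈ rootSet H) (hy : y ∈ rootSet H)
    (hz : z ∈ outerRoots Γ) (h : x + y + z = 0) {δ : Module.Dual ℂ H} (hδ : δ ∈ rootSet H)
    (hδΓ : δ ∈ leviSpan Γ) (hxδ : x + δ ∈ rootSet H) (hyδ : y - δ ∈ rootSet H) :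
    ∃ c : ℂ, ∀ w ∈ invariants Γ 3, tri (R.vec (x + δ)) (R.vec (y - δ)) (R.vec z) w =
      c * tri (R.vec x) (R.vec y) (R.vec z) w := by
  have hδz : ⁅R.vec δ, R.vec z⁆ = (0 : ℂ) • 0 := by
    rw [smul_zero]
    refine R.lie_vec_eq_zero hδ hz.1 (fun h0 => hz.2 ?_)
      (add_notMem_rootSet_of_move hs hx hy hz.1 h hδ hxδ hyδ)
    rw [eq_neg_of_add_eq_zero_right h0]
    exact (leviSpan Γ).neg_mem hδΓ
  have hδx : δ + x ∈ rootSet H := by rwa [add_comm]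
  have hδy : δ + (y - δ) ∈ rootSet H := by rwa [add_sub_cancel]
  have hp := R.lie_vec_eq_smul hδ hx hδx
  have hq := R.lie_vec_eq_smul hδ hyδ hδy
  have hp0 := R.lie_vec_ne_zero hs hδ hx hδx
  rw [hp] at hp0
  have hp0 := (smul_ne_zero_iff.1 hp0).1
  generalize killingForm ℂ L ⁅R.vec δ, R.vec x⁆ (R.vec (-(δ + x))) = p at hp hp0
  generalize killingForm ℂ L ⁅R.vec δ, R.vec (y - δ)⁆ (R.vec (-(δ + (y - δ)))) = q at hq
  refine ⟨-q / p, fun w hw => ?_⟩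
  have had := tri_adExt (R.vec δ) (R.vec x) (R.vec (y - δ)) (R.vec z) w
  rw [adExt_eq_zero hw (vec_mem_levi R hs hΓ hδ hδΓ), map_zero, hp, hq, hδz, tri_smul_left,
    tri_smul_mid, tri_smul_right, add_sub_cancel, add_comm δ] at had
  field_simp
  linear_combination had

theorem tri_phiM_ne_zero (hx : x ∈ outerRoots Γ) (hy : y ∈ outerRoots Γ) (hz : z ∈ outerRoots Γ)
    (h : x + y + z = 0) : tri (R.vec x) (R.vec y) (R.vec z) (phiM R b Γ) ≠ 0 := by
  rw [tri_phiM_vec R hx hy hz]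
  exact mul_ne_zero (by norm_num) (killingForm_lie_vec_ne_zero R hs hx.1 hy.1 hz.1 h)

theorem isMoveInvariant_div (hΓ : Γ ⊆ b.support) {θ : L ≃ₗ⁅ℂ⁆ L} (hθ : IsCartanAutomorphism H θ)
    {w : ⋀[ℂ]^3 L} (hw : w ∈ thetaInvariants Γ θ 3) {M : Type*} [AddCommGroup M]
    {l : Module.Dual ℂ H →+ M} (hl : ∀ x ∈ rootSet H, l x = 0 ↔ x ∈ leviSpan Γ) :
    IsMoveInvariant (rootSet H) l fun x y z =>
      tri (R.vec x) (R.vec y) (R.vec z) w / tri (R.vec x) (R.vec y) (R.vec z) (phiM R b Γ) := by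
  have hout : ∀ {x}, x ∈ rootSet H → l x ≠ 0 → x ∈ outerRoots Γ := fun hx h =>
    ⟨hx, fun hxΓ => h ((hl _ hx).2 hxΓ)⟩
  have hφ := phiM_mem_thetaInvariants (b := b) (Γ := Γ) R hθ
  have div_eq : ∀ {p q p' q' c : ℂ}, q' ≠ 0 → p' = c * p → q' = c * q → p' / q' = p / q :=
    fun hq' hp hq => by rw [hp, hq, mul_div_mul_left _ _ (left_ne_zero_of_mul (hq ▸ hq'))]
  refine ⟨fun x y z _ => ?rotate, fun x y z _ => ?swap, fun x y z h => ?neg,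
    fun x y z h δ hδ hlδ hxδ hyδ => ?move⟩
  case rotate => simp only [tri_rotate]
  case swap => simp only [tri_swap (R.vec x) (R.vec y), neg_div_neg_eq]
  all_goals
    have hx := hout h.mem₁ h.level₁
    have hy := hout h.mem₂ h.level₂
    have hz := hout h.mem₃ h.level₃
  case neg =>
    obtain ⟨c, hc⟩ := exists_tri_vec_neg_eq_mul (Γ := Γ) R hθ hx.1 hy.1 hz.1
    refine div_eq (tri_phiM_ne_zero R hs (neg_mem_outerRoots hx) (neg_mem_outerRoots hy)
      (neg_mem_outerRoots hz) ?_) (hc w hw) (hc _ hφ)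
    rw [← neg_add, ← neg_add, h.sum, neg_zero]
  case move =>
    obtain ⟨c, hc⟩ := exists_tri_vec_move_eq_mul R hs hΓ hx.1 hy.1 hz h.sum hδ ((hl δ hδ).1 hlδ)
      hxδ hyδ
    have hlx : l (x + δ) ≠ 0 := by rw [map_add, hlδ, add_zero]; exact h.level₁
    have hly : l (y - δ) ≠ 0 := by rw [map_sub, hlδ, sub_zero]; exact h.level₂
    refine div_eq (tri_phiM_ne_zero R hs (hout hxδ hlx) (hout hyδ hly) hz ?_) (hc w hw.1)
      (hc _ hφ.1)
    rw [add_add_sub_cancel, h.sum]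

theorem lie_vec_mem_levi_of_phiM_eq_zero (hΓ : Γ ⊆ b.support) (h0 : phiM R b Γ = 0)
    (hx : x ∈ outerRoots Γ) (hy : y ∈ outerRoots Γ) : ⁅R.vec x, R.vec y⁆ ∈ levi Γ := by
  by_cases hxy : x + y = 0
  · obtain ⟨i, rfl⟩ := hx.1
    rw [eq_neg_of_add_eq_zero_right hxy, R.lie_vec_neg]
    exact cartan_le_levi (SetLike.coe_mem _)
  by_cases hm : x + y ∈ rootSet H
  · rw [R.lie_vec_eq_smul hx.1 hy.1 hm]
    refine (levi Γ).smul_mem _ (vec_mem_levi R hs hΓ hm ?_)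
    by_contra hΓ'
    refine tri_phiM_ne_zero R hs hx hy (neg_mem_outerRoots ⟨hm, hΓ'⟩) (add_neg_cancel _) ?_
    rw [h0, map_zero]
  · rw [R.lie_vec_eq_zero hx.1 hy.1 hxy hm]
    exact zero_mem _

theorem isSymmetricOrbit_of_phiM_eq_zero (hΓ : Γ ⊆ b.support) (h0 : phiM R b Γ = 0) :
    IsSymmetricOrbit Γ := by
  intro m hm m' hm'
  rw [tangent_eq_span R] at hm hm'
  refine Submodule.span_induction₂ (p := fun m m' _ _ => ⁅m, m'⁆ ∈ levi Γ) ?_ ?_ ?_ ?_ ?_ ?_ ?_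
    hm hm'
  · rintro _ _ ⟨x, hx, rfl⟩ ⟨y, hy, rfl⟩
    exact lie_vec_mem_levi_of_phiM_eq_zero R hs hΓ h0 hx hy
  · intro m _; rw [zero_lie]; exact zero_mem _
  · intro m _; rw [lie_zero]; exact zero_mem _
  · intro _ _ _ _ _ _ h₁ h₂; rw [add_lie]; exact add_mem h₁ h₂
  · intro _ _ _ _ _ _ h₁ h₂; rw [lie_add]; exact add_mem h₁ h₂
  · intro c _ _ _ _ h; rw [smul_lie]; exact (levi Γ).smul_mem _ h
  · intro c _ _ _ _ h; rw [lie_smul]; exact (levi Γ).smul_mem _ h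

omit hs in
theorem thetaInvariants_le_span (hb : HasStarDiagram b) (hΓ : Γ ⊆ b.support) {θ : L ≃ₗ⁅ℂ⁆ L}
    (hθ : IsCartanAutomorphism H θ) (hgood : IsGood R b Γ) :
    thetaInvariants Γ θ 3 ≤ Submodule.span ℂ {phiM R b Γ} := by
  intro w hw
  obtain ⟨o, p, node, hstar⟩ := hb
  have hs := hstar.isSymm
  have hB := isSimplyLaced_range_root hs
  have hbased := isBased_range_root b
  obtain ⟨t, ht, f, hf, K, hK, hff, hkks⟩ := hgood
  obtain ⟨lam, g, hC, ha⟩ := exists_isGoodPair R ht hf hs hkks hΓ hff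
  obtain ⟨j, k, hjk, hjkΓ⟩ := hstar.exists_pair_of_notMem
    (fun i j : b.support => rootForm_root hs (i : H.root) j) hB hbased hK hC ha
  have hl : ∀ x ∈ rootSet H, outerLevel (baseCoord b) _ j k x = 0 ↔ x ∈ leviSpan Γ := fun x hx =>
    (outerLevel_eq_zero_iff hjkΓ).trans (mem_leviSpan_iff hΓ hx).symm
  obtain ⟨C, hconst⟩ := IsMoveInvariant.exists_const_of_isGoodPair hjkΓ hbased hjk hK hC ha hB
    (isMoveInvariant_div R hs hΓ hθ hw hl)
  have hφ := phiM_mem_thetaInvariants (b := b) (Γ := Γ) R hθ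
  rw [Submodule.mem_span_singleton]
  refine ⟨C, eq_of_tri R (Submodule.smul_mem _ _ hφ.1.1) hw.1.1 fun x hx y hy z hz => ?_⟩
  rw [map_smul, smul_eq_mul]
  by_cases h : x + y + z = 0
  · have hlevel : ∀ x ∈ outerRoots Γ, outerLevel (baseCoord b) _ j k x ≠ 0 := fun x hx =>
      mt (hl x hx.1).1 hx.2
    rw [← hconst x y z ⟨hx.1, hy.1, hz.1, h, hlevel x hx, hlevel y hy, hlevel z hz⟩,
      div_mul_cancel₀ _ (tri_phiM_ne_zero R hs hx hy hz h)]
  · rw [tri_vec_eq_zero R hφ.1 hx.1 hy.1 hz.1 h, tri_vec_eq_zero R hw.1 hx.1 hy.1 hz.1 h,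
      mul_zero]

end Trivectors

theorem IsTypeDOrE₆.hasStarDiagram {b : (rootSystem H).Base} (hb : IsTypeDOrE₆ b) :
    HasStarDiagram b := by
  rcases hb with ⟨n, hn, e, he⟩ | ⟨e, he⟩
  · obtain ⟨m, rfl⟩ := Nat.exists_eq_add_of_le' (show 3 ≤ n by omega)
    exact ⟨_, _, _, (isStarShaped_D (by omega)).of_equiv e he⟩
  · exact ⟨_, _, _, isStarShaped_E₆.of_equiv e he⟩

end LieOrbit

end

theorem lemma4p1_general {L : Type*} [LieRing L] [LieAlgebra ℂ L] [FiniteDimensional ℂ L]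
    [LieAlgebra.IsSimple ℂ L] (H : LieSubalgebra ℂ L) [H.IsCartanSubalgebra]
    (b : (LieAlgebra.IsKilling.rootSystem H).Base) (hb : LieOrbit.HasStarDiagram b)
    (R : LieOrbit.RootVectors H)
    (θ : L ≃ₗ⁅ℂ⁆ L) (hθ : LieOrbit.IsCartanAutomorphism H θ)
    (Γ : Finset H.root) (hΓ : Γ ⊆ b.support) (hgood : LieOrbit.IsGood R b Γ) :
    LieOrbit.thetaInvariants Γ θ 3 = Submodule.span ℂ {LieOrbit.phiM R b Γ} ∧
      (¬ LieOrbit.IsSymmetricOrbit Γ →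
        Module.finrank ℂ (LieOrbit.thetaInvariants Γ θ 3) = 1) := by
  have hspan : LieOrbit.thetaInvariants Γ θ 3 = Submodule.span ℂ {LieOrbit.phiM R b Γ} :=
    (LieOrbit.thetaInvariants_le_span R hb hΓ hθ hgood).antisymm
      ((Submodule.span_singleton_le_iff_mem _ _).2 (LieOrbit.phiM_mem_thetaInvariants R hθ))
  obtain ⟨o, p, node, hstar⟩ := hb
  refine ⟨hspan, fun hsymm => ?_⟩
  rw [hspan]
  exact finrank_span_singleton fun h0 =>
    hsymm (LieOrbit.isSymmetricOrbit_of_phiM_eq_zero R hstar.isSymm hΓ h0)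

theorem lemma4p1 {L : Type*} [LieRing L] [LieAlgebra ℂ L] [FiniteDimensional ℂ L]
    [LieAlgebra.IsSimple ℂ L] (H : LieSubalgebra ℂ L) [H.IsCartanSubalgebra]
    (b : (LieAlgebra.IsKilling.rootSystem H).Base) (hb : LieOrbit.IsTypeDOrE₆ b)
    (R : LieOrbit.RootVectors H)
    (θ : L ≃ₗ⁅ℂ⁆ L) (hθ : LieOrbit.IsCartanAutomorphism H θ)
    (Γ : Finset H.root) (hΓ : Γ ⊆ b.support) (hgood : LieOrbit.IsGood R b Γ) :
    LieOrbit.thetaInvariants Γ θ 3 = Submodule.span ℂ {LieOrbit.phiM R b Γ} ∧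
      (¬ LieOrbit.IsSymmetricOrbit Γ →
        Module.finrank ℂ (LieOrbit.thetaInvariants Γ θ 3) = 1) :=
  lemma4p1_general H b hb.hasStarDiagram R θ hθ Γ hΓ hgood
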